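/- Let $[r]$ be a finite set of colors. All colorings are edge-colorings with colors in $[r]$, and graphs are simple and undirected. Let $m\ge 3$ and let $\mathcal F$ be a finite family of finite edge-colored graphs such that (a) every member of $\mathcal F$ is a coloring of an odd cycle or of a clique with at least $3$ vertices; (b) every colored cycle in $\mathcal F$ of length at least $5$ is monochromatic (a triangle is regarded as a clique), and every non-monochromatic colored clique in $\mathcal F$ has at least $m$ vertices; (c) if some non-monochromatic coloring of $K_m$ is in $\mathcal F$, then all colorings of $K_m$ are in $\mathcal F$, up to isomorphism. Suppose moreover that for every color $i\in[r]$ the family $\mathcal F$ contains a $K_m$-free graph all of whose edges have color $i$. Definitions. A colored graph $(G,\gamma)$ is $\mathcal F$-free if no member of $\mathcal F$ has a color-preserving graph homomorphism to it. For a partial coloring $\xi$ of $E(G)$, an $\mathcal F$-free extension of $\xi$ is a coloring $\gamma$ of all of $E(G)$ that agrees with $\xi$ on $\operatorname{dom}\xi$ and for which $(G,\gamma)$ is $\mathcal F$-free. For an edge $e\notin\operatorname{dom}\xi$, the pair $(G,\xi)$ is $\mathcal F$-safe along $e$ if $\xi$ has an $\mathcal F$-free extension and, for every $\mathcal F$-free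 colored graph $(H,\gamma_H)$ and every edge $f$ of $H$ such that $\gamma_H(f)=\gamma(e)$ for some $\mathcal F$-free extension $\gamma$ of $\xi$, the graph obtained from the disjoint union of $G$ and $H$ by identifying $e$ with $f$ (in either of the two directions) has an $\mathcal F$-free coloring extending both $\xi$ and $\gamma_H$. A colored $i$-determiner is a triple $(G,\xi,e)$, with $\xi$ a partial coloring of $E(G)$ and $e\in E(G)\setminus\operatorname{dom}\xi$, such that one of the two endpoints of $e$ is incident to no edge of $\operatorname{dom}\xi$, $\xi$ has an $\mathcal F$-free extension, and every $\mathcal F$-free extension $\gamma$ of $\xi$ satisfies $\gamma(e)=i$. It is $\mathcal F$-safe if $(G,\xi)$ is $\mathcal F$-safe along $e$. Then: (1) There is a finite graph $H$ with a vertex $x$ such that $H$ has an $\mathcal F$-free coloring, and for every $\mathcal F$-free coloring $\gamma$ of $H$ and every color $i$ there is an edge $e$ incident to $x$ with $\gamma(e)=i$. (2) If $r\ge 2$, then for every color $i$ there are a finite graph $D$, a partial coloring $\xi$ of $E(D)$ and an edge $f\in E(D)$ such that $\gamma(f)\ne i$ for every $\mathcal F$-free extension $\gamma$ of $\xi$,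 $(D,\xi)$ is $\mathcal F$-safe along $f$, and some endpoint of $f$ lies on no edge of $\operatorname{dom}\xi$. (3) For every color $i$ there is an $\mathcal F$-safe colored $i$-determiner $(G,\xi,e)$ with $G$ finite. -/

import Mathlib

open SimpleGraph

namespace EdgeCol

/-- A finite graph together with a total coloring of its edges by the colors `Fin r`. -/
structure FinColoredGraph (r : ℕ) where
  /-- the vertices -/
  V : Type
  fin : Finite V
  /-- the underlying graph -/
  graph : SimpleGraph V
  /-- the color of each edge -/
  color : graph.EdgeLabeling (Fin r)

namespace FinColoredGraph

variable {r : ℕ}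

/-- All edges have color `i`. -/
def MonoOf (A : FinColoredGraph r) (i : Fin r) : Prop := ∀ e, A.color e = i

/-- All edges have the same color. -/
def Mono (A : FinColoredGraph r) : Prop := ∃ i, A.MonoOf i

/-- The underlying graph is a cycle of odd length (at least 3). -/
def IsOddCycle (A : FinColoredGraph r) : Prop :=
  ∃ n : ℕ, 3 ≤ n ∧ Odd n ∧ Nonempty (A.graph ≃g cycleGraph n)

/-- The underlying graph is a complete graph on `n` vertices. -/
def IsCliqueOn (A : FinColoredGraph r) (n : ℕ) : Prop :=
  Nat.card A.V = n ∧ A.graph = ⊤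

/-- Isomorphism of edge-colored graphs. -/
def Isom (A B : FinColoredGraph r) : Prop :=
  ∃ φ : A.graph ≃g B.graph, ∀ e, B.color (φ.mapEdgeSet e) = A.color e

/-- The clique on `Fin m` with a given edge-coloring. -/
def cliqueWith (m : ℕ) (c : (⊤ : SimpleGraph (Fin m)).EdgeLabeling (Fin r)) :
    FinColoredGraph r :=
  ⟨Fin m, inferInstance, ⊤, c⟩

end FinColoredGraph

/-- The families of obstructions of the dichotomy theorem. A triangle counts as a clique in
`cycle_mono`, so that colorings of `K_3` are governed by the two clauses about cliques. -/
structure IsCycleCliqueFamily {r : ℕ} (m : ℕ) (F : Set (FinColoredGraph r)) : Prop where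
  finite : F.Finite
  shape : ∀ A ∈ F, A.IsOddCycle ∨ ∃ n, 3 ≤ n ∧ A.IsCliqueOn n
  cycle_mono : ∀ A ∈ F, A.IsOddCycle → A.graph ≠ ⊤ → A.Mono
  le_of_not_mono : ∀ A ∈ F, ¬ A.Mono → ∀ n, A.IsCliqueOn n → m ≤ n
  all_of_not_mono : (∃ A ∈ F, A.IsCliqueOn m ∧ ¬ A.Mono) →
    ∀ c, ∃ A ∈ F, A.Isom (FinColoredGraph.cliqueWith m c)

/-- `(G, γ)` is `F`-free: no member of `F` has a color-preserving homomorphism to it. -/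
def IsFree {r : ℕ} (F : Set (FinColoredGraph r)) {V : Type} (G : SimpleGraph V)
    (γ : G.EdgeLabeling (Fin r)) : Prop :=
  ∀ A ∈ F, ¬ ∃ h : A.graph →g G, ∀ e, γ (h.mapEdgeSet e) = A.color e

/-- A partial edge-coloring; `none` marks the edges outside its domain. -/
abbrev PartialColoring {V : Type} (G : SimpleGraph V) (r : ℕ) : Type :=
  G.EdgeLabeling (Option (Fin r))

/-- The total coloring `γ` extends the partial coloring `ξ`. -/
def Extends {r : ℕ} {V : Type} {G : SimpleGraph V} (γ : G.EdgeLabeling (Fin r))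
    (ξ : PartialColoring G r) : Prop :=
  ∀ e c, ξ e = some c → γ e = c

/-- `γ` is an `F`-free extension of `ξ`. -/
def IsFreeExtension {r : ℕ} (F : Set (FinColoredGraph r)) {V : Type} (G : SimpleGraph V)
    (ξ : PartialColoring G r) (γ : G.EdgeLabeling (Fin r)) : Prop :=
  Extends γ ξ ∧ IsFree F G γ

section Glue

variable {V W : Type} {G : SimpleGraph V} {H : SimpleGraph W}

/-- The vertices of the graph obtained from `G` and `H` by identifying the first endpoint of `f`
with the first endpoint of `d` and the second one with the second one. -/
abbrev GlueVert (_d : G.Dart) (f : H.Dart) : Type :=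
  V ⊕ {w : W // w ≠ f.fst ∧ w ≠ f.snd}

open Classical in
/-- The position of the vertices of `H` in the glued graph. -/
noncomputable def glueRight (d : G.Dart) (f : H.Dart) (w : W) : GlueVert d f :=
  if h₁ : w = f.fst then Sum.inl d.fst
  else if h₂ : w = f.snd then Sum.inl d.snd
  else Sum.inr ⟨w, h₁, h₂⟩

theorem glueRight_injective (d : G.Dart) (f : H.Dart) :
    Function.Injective (glueRight d f) := by
  intro u w h
  have hd : d.fst ≠ d.snd := d.adj.ne
  unfold glueRight at h
  split_ifs at h <;> simp_all

/-- The graph obtained by gluing `G` and `H` along the oriented edges `d` and `f`. -/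
noncomputable def glue (d : G.Dart) (f : H.Dart) : SimpleGraph (GlueVert d f) where
  Adj x y := (∃ u v, G.Adj u v ∧ x = Sum.inl u ∧ y = Sum.inl v) ∨
    (∃ u v, H.Adj u v ∧ x = glueRight d f u ∧ y = glueRight d f v)
  symm := ⟨by
    rintro x y (⟨u, v, h, hx, hy⟩ | ⟨u, v, h, hx, hy⟩)
    · exact Or.inl ⟨v, u, h.symm, hy, hx⟩
    · exact Or.inr ⟨v, u, h.symm, hy, hx⟩⟩
  loopless := ⟨by
    rintro x (⟨u, v, h, hx, hy⟩ | ⟨u, v, h, hx, hy⟩)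
    · exact h.ne (Sum.inl_injective (hx.symm.trans hy))
    · exact h.ne (glueRight_injective d f (hx.symm.trans hy))⟩

/-- The copy of `G` in the glued graph. -/
noncomputable def glueInl (d : G.Dart) (f : H.Dart) : G →g glue d f where
  toFun := Sum.inl
  map_rel' h := Or.inl ⟨_, _, h, rfl, rfl⟩

/-- The copy of `H` in the glued graph. -/
noncomputable def glueInr (d : G.Dart) (f : H.Dart) : H →g glue d f where
  toFun := glueRight d f
  map_rel' h := Or.inr ⟨_, _, h, rfl, rfl⟩

end Glue

/-- `(G, ξ)` is `F`-safe along the uncolored edge `e`: it has an `F`-free extension, and whenever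
an edge `f` of an `F`-free colored graph `(H, γH)` has a color that some `F`-free extension of `ξ`
gives to `e`, gluing `H` to `G` along `e` and `f`, in either direction, yields a graph with an
`F`-free coloring that extends both `ξ` and `γH`. -/
def IsSafe {r : ℕ} (F : Set (FinColoredGraph r)) {V : Type} (G : SimpleGraph V)
    (ξ : PartialColoring G r) (e : G.edgeSet) : Prop :=
  ξ e = none ∧
  (∃ γ, IsFreeExtension F G ξ γ) ∧
  ∀ (W : Type) (H : SimpleGraph W) (γH : H.EdgeLabeling (Fin r)), IsFree F H γH →
    ∀ (d : G.Dart) (f : H.Dart), d.edge = e →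
      (∃ γ, IsFreeExtension F G ξ γ ∧ γH ⟨f.edge, f.edge_mem⟩ = γ e) →
      ∃ δ : (glue d f).EdgeLabeling (Fin r),
        IsFree F (glue d f) δ ∧
        Extends (fun e' => δ ((glueInl d f).mapEdgeSet e')) ξ ∧
        ∀ e', δ ((glueInr d f).mapEdgeSet e') = γH e'

/-- Some endpoint of `e` lies on no edge that is colored by `ξ`. -/
def HasFreeEndpoint {r : ℕ} {V : Type} {G : SimpleGraph V}
    (ξ : PartialColoring G r) (e : G.edgeSet) : Prop :=
  ∃ x ∈ (e : Sym2 V), ∀ e' : G.edgeSet, ξ e' ≠ none → x ∉ (e' : Sym2 V)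

/-- `(G, ξ, e)` is a colored `i`-determiner. -/
structure IsDeterminer {r : ℕ} (F : Set (FinColoredGraph r)) (i : Fin r) {V : Type}
    (G : SimpleGraph V) (ξ : PartialColoring G r) (e : G.edgeSet) : Prop where
  uncolored : ξ e = none
  free_endpoint : HasFreeEndpoint ξ e
  exists_extension : ∃ γ, IsFreeExtension F G ξ γ
  forces : ∀ γ, IsFreeExtension F G ξ γ → γ e = i

end EdgeCol

namespace EdgeCol

/-! A member of `F` that is not monochromatic is a clique on at least `m` vertices, so in a
`K_m`-free graph only monochromatic members obstruct a coloring. The Folkman-type theorem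
`exists_cliqueFree_arrow`, applied to the disjoint union of one `K_m`-free monochromatic member per
color, gives a finite `K_m`-free graph without an `F`-free coloring. Passing to a minimal such graph
and deleting an edge `xy` leaves a colorable graph `D` in which every `F`-free coloring is blocked
at `xy` in all colors: giving `xy` the color `i` creates a member of color `i`
(`exists_blocked_edge`).

A pendant edge never helps to map a clique or an odd cycle (`nonempty_hom_of_pendant`). Hence every
color occurs at `x`, since otherwise `xy` would be pendant in the class of a missing color. This is
(1).

For (2) and (3), the coloring of the edges away from `x` is prescribed, and the blockage is kept for
a single color `i`. To this end `y` is replaced by a new vertex `y'`, attached by edges precolored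
`i` (`isAvoider_attach`). In any other color the edge `xy'` is pendant, hence harmless. If all
members of color `i` are cliques, `y'` is a twin of `y` in color `i`; if some member is an odd cycle
of length at least 5, `y'` is the common end of long legs starting at all vertices but `x`, and an
`i`-colored edge at `x` closes up a longest such cycle.

The invariant `IsAvoider` records that exactly the colors outside `S` remain possible, each by an
extension with `LongWalks`. Gluing along the edge is then harmless (`isFree_glue`): cliques stay on
one side, walks in the color of the edge combine with even total length, and walks in other colors
are too long. So avoiders are safe, and gluing two of them unites their forbidden sets
(`IsAvoider.glue`). Forbidding `{i}` gives (2), forbidding all colors but `i` gives (3). -/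

theorem cliqueFree_iff_isEmpty_hom {V : Type*} {G : SimpleGraph V} {n : ℕ} :
    G.CliqueFree n ↔ IsEmpty ((⊤ : SimpleGraph (Fin n)) →g G) := by
  rw [SimpleGraph.cliqueFree_iff]
  constructor
  · intro h
    exact ⟨fun f => h.false ⟨f, fun a b hab => by
      by_contra hne
      exact (f.map_adj (show (⊤ : SimpleGraph (Fin n)).Adj a b from hne)).ne hab⟩⟩
  · intro h
    exact ⟨fun f => h.false f.toHom⟩

theorem CliqueFree.of_hom {V W : Type*} {G : SimpleGraph V} {H : SimpleGraph W} {n : ℕ}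
    (f : G →g H) (h : H.CliqueFree n) : G.CliqueFree n := by
  rw [cliqueFree_iff_isEmpty_hom] at h ⊢
  exact ⟨fun g => h.false (f.comp g)⟩

/-! ### Ramsey's theorem for pairs -/

section Ramsey

/-- In a large set, every pair coloring is determined, on a subset of prescribed size, by a vertex
coloring: the color of a pair is the color of one of its two vertices. -/
theorem exists_endHomogeneous (r : ℕ) (n : ℕ) :
    ∃ N : ℕ, ∀ {α : Type} [DecidableEq α] (χ : Sym2 α → Fin r) (X : Finset α), N ≤ X.card →
      ∃ Y ⊆ X, Y.card = n ∧ ∃ κ : α → Fin r, ∀ u ∈ Y, ∀ v ∈ Y, u ≠ v →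
        χ s(u, v) = κ u ∨ χ s(u, v) = κ v := by
  induction n with
  | zero =>
    -- The bound 1 rather than 0 provides a vertex, and thereby a color for the values of `κ`.
    refine ⟨1, fun {α} _ χ X hX => ⟨∅, by simp, rfl, ?_⟩⟩
    obtain ⟨x, -⟩ := Finset.card_pos.1 hX
    exact ⟨fun _ => χ s(x, x), by simp⟩
  | succ n ih =>
    obtain ⟨N, hN⟩ := ih
    -- Once `x` is removed, more than `r * N` vertices remain, so more than `N` of them are joined
    -- to `x` in one color `k`, which becomes the color of `x`.
    refine ⟨r * N + 2, fun {α} _ χ X hX => ?_⟩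
    obtain ⟨x, hx⟩ := Finset.card_pos.1 (by omega : 0 < X.card)
    have hcard : (Finset.univ : Finset (Fin r)).card * N < (X.erase x).card := by
      rw [Finset.card_erase_of_mem hx, Finset.card_univ, Fintype.card_fin]; omega
    obtain ⟨k, -, hk⟩ := Finset.exists_lt_card_fiber_of_mul_lt_card_of_maps_to
      (f := fun y => χ s(x, y)) (fun a _ => Finset.mem_univ _) hcard
    obtain ⟨Y, hY, hYn, κ, hκ⟩ := hN χ _ hk.le
    have hxY : x ∉ Y := fun h => by simpa using hY h
    have hc : ∀ y ∈ Y, χ s(x, y) = k := fun y hy => (Finset.mem_filter.1 (hY hy)).2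
    refine ⟨insert x Y, ?_, by rw [Finset.card_insert_of_notMem hxY, hYn],
      Function.update κ x k, ?_⟩
    · intro y hy
      rcases Finset.mem_insert.1 hy with rfl | hy
      · exact hx
      · exact Finset.mem_of_mem_erase (Finset.mem_filter.1 (hY hy)).1
    · intro u hu v hv huv
      rcases Finset.mem_insert.1 hu with rfl | hu
      · left
        rcases Finset.mem_insert.1 hv with rfl | hv
        · exact absurd rfl huv
        · simp [hc v hv]
      · have hux : u ≠ x := fun h => hxY (h ▸ hu)
        rcases Finset.mem_insert.1 hv with rfl | hv
        · right
          rw [Sym2.eq_swap]; simp [hc u ‹u ∈ Y›]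
        · have hvx : v ≠ x := fun h => hxY (h ▸ hv)
          simpa [Function.update_of_ne hux, Function.update_of_ne hvx] using hκ u hu v hv huv

/-- Ramsey's theorem for pairs and `r` colors. -/
theorem exists_ramsey (r : ℕ) (β : Type) [Finite β] :
    ∃ N : ℕ, ∀ χ : Sym2 (Fin N) → Fin r, ∃ (σ : β ↪ Fin N) (k : Fin r) , ∀ u v, u ≠ v →
      χ s(σ u, σ v) = k := by
  classical
  have := Fintype.ofFinite β
  obtain ⟨N, hN⟩ := exists_endHomogeneous r (r * Fintype.card β + 1)
  refine ⟨N, fun χ => ?_⟩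
  obtain ⟨Y, -, hYn, κ, hκ⟩ := hN χ Finset.univ (by simp)
  obtain ⟨k, -, hk⟩ := Finset.exists_lt_card_fiber_of_mul_lt_card_of_maps_to
    (s := Y) (t := Finset.univ) (f := κ) (n := Fintype.card β) (fun a _ => Finset.mem_univ _)
    (by rw [Finset.card_univ, Fintype.card_fin]; omega)
  obtain ⟨f⟩ : Nonempty (β ↪ {y // y ∈ Y.filter (fun y => κ y = k)}) :=
    Function.Embedding.nonempty_of_card_le (by rw [Fintype.card_coe]; exact hk.le)
  refine ⟨f.trans (Function.Embedding.subtype _), k, fun u v huv => ?_⟩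
  have hu := Finset.mem_filter.1 (f u).2
  have hv := Finset.mem_filter.1 (f v).2
  have := hκ _ hu.1 _ hv.1 (fun h => huv (f.injective (Subtype.ext h)))
  rw [hu.2, hv.2, or_self] at this
  exact this

end Ramsey

/-! ### The partite construction and the Folkman-type theorem -/

section Partite

variable {I V ι : Type} {P : SimpleGraph V} {p : V → I} {a b : I}

/-- The edges of `P` from part `a` to part `b`. -/
abbrev PartEdges (P : SimpleGraph V) (p : V → I) (a b : I) : Type :=
  {e : V × V // P.Adj e.1 e.2 ∧ p e.1 = a ∧ p e.2 = b}

open Classical in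
/-- The copy of `P` on the line `l` of the partite amalgam. The vertices outside the parts `a` and
`b` are private to the copy. -/
noncomputable def lineEmb (P : SimpleGraph V) (p : V → I) (a b : I) (ι : Type)
    (l : Combinatorics.Line (PartEdges P p a b) ι) (v : V) :
    (Combinatorics.Line (PartEdges P p a b) ι × V) ⊕ (ι → V) :=
  if p v = a ∨ p v = b then
    Sum.inr fun j => (l.idxFun j).elim v fun e => if p v = a then e.1.1 else e.1.2
  else Sum.inl (l, v)

open Classical in
/-- The part of a vertex of the partite amalgam. -/
noncomputable def linePart (P : SimpleGraph V) (p : V → I) (a b : I) (ι : Type) :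
    (Combinatorics.Line (PartEdges P p a b) ι × V) ⊕ (ι → V) → I
  | Sum.inl q => p q.2
  | Sum.inr f => if ∀ j, p (f j) = a then a else b

open Classical in
theorem lineEmb_inside (l : Combinatorics.Line (PartEdges P p a b) ι) {v : V}
    (h : p v = a ∨ p v = b) : lineEmb P p a b ι l v =
      Sum.inr fun j => (l.idxFun j).elim v fun e => if p v = a then e.1.1 else e.1.2 := by
  rw [lineEmb, if_pos h]

theorem lineEmb_outside (l : Combinatorics.Line (PartEdges P p a b) ι) {v : V}
    (h : ¬ (p v = a ∨ p v = b)) : lineEmb P p a b ι l v = Sum.inl (l, v) := by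
  rw [lineEmb, if_neg h]

/-- All coordinates of a word on a copy lie in one part, and a moving coordinate shows `v` itself.
Words that mix parts lie on no copy, so their part is immaterial. -/
theorem linePart_lineEmb (hab : a ≠ b) (l : Combinatorics.Line (PartEdges P p a b) ι) (v : V) :
    linePart P p a b ι (lineEmb P p a b ι l v) = p v := by
  by_cases h : p v = a ∨ p v = b
  · rw [lineEmb_inside l h]
    obtain ⟨j₀, hj₀⟩ := l.proper
    rcases h with h | h
    · simp only [linePart]
      rw [if_pos, h]
      intro j
      cases hj : l.idxFun j with
      | none => simpa using h
      | some e => simpa [h] using e.2.2.1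
    · simp only [linePart]
      rw [if_neg, h]
      intro hall
      have := hall j₀
      simp only [hj₀, Option.elim_none] at this
      exact hab (this.symm.trans h)
  · rw [lineEmb_outside l h, linePart]

theorem lineEmb_injective (hab : a ≠ b) (l : Combinatorics.Line (PartEdges P p a b) ι) :
    Function.Injective (lineEmb P p a b ι l) := by
  intro u v h
  have hp : p u = p v := by
    rw [← linePart_lineEmb hab l u, ← linePart_lineEmb hab l v, h]
  obtain ⟨j₀, hj₀⟩ := l.proper
  by_cases h' : p v = a ∨ p v = b
  · rw [lineEmb_inside l h', lineEmb_inside l (hp ▸ h')] at h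
    simpa [hj₀] using congrFun (Sum.inr_injective h) j₀
  · rw [lineEmb_outside l h', lineEmb_outside l (hp ▸ h')] at h
    exact (Prod.ext_iff.1 (Sum.inl_injective h)).2

/-- If two copies share a vertex outside the parts `a` and `b`, they coincide. -/
theorem lineEmb_eq_of_outside (hab : a ≠ b) {l l' : Combinatorics.Line (PartEdges P p a b) ι}
    {u v : V} (hu : ¬ (p u = a ∨ p u = b)) (h : lineEmb P p a b ι l u = lineEmb P p a b ι l' v) :
    l = l' ∧ u = v := by
  have hp : p u = p v := by
    rw [← linePart_lineEmb hab l u, ← linePart_lineEmb hab l' v, h]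
  rw [lineEmb_outside l hu, lineEmb_outside l' (hp ▸ hu)] at h
  exact Prod.ext_iff.1 (Sum.inl_injective h)

/-- The amalgam of copies of `P`, one for each line, along the edges from part `a` to part `b`. -/
noncomputable def lineAmalgam (P : SimpleGraph V) (p : V → I) (a b : I) (ι : Type) (hab : a ≠ b)
    (hp : ∀ u v, P.Adj u v → p u ≠ p v) :
    SimpleGraph ((Combinatorics.Line (PartEdges P p a b) ι × V) ⊕ (ι → V)) where
  Adj x y := ∃ l u v, P.Adj u v ∧ x = lineEmb P p a b ι l u ∧ y = lineEmb P p a b ι l v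
  symm := ⟨fun _ _ ⟨l, u, v, h, hx, hy⟩ => ⟨l, v, u, h.symm, hy, hx⟩⟩
  loopless := ⟨fun x ⟨l, u, v, h, hx, hy⟩ => hp u v h (by
    rw [← linePart_lineEmb hab l u, ← linePart_lineEmb hab l v, ← hx, ← hy])⟩

theorem linePart_ne_of_adj (hab : a ≠ b) (hp : ∀ u v, P.Adj u v → p u ≠ p v) {x y}
    (h : (lineAmalgam P p a b ι hab hp).Adj x y) :
    linePart P p a b ι x ≠ linePart P p a b ι y := by
  obtain ⟨l, u, v, huv, rfl, rfl⟩ := h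
  rw [linePart_lineEmb hab, linePart_lineEmb hab]
  exact hp u v huv

/-- The copies of `P` are induced subgraphs of the amalgam. -/
theorem adj_of_lineAmalgam_adj (hab : a ≠ b) (hp : ∀ u v, P.Adj u v → p u ≠ p v)
    (l : Combinatorics.Line (PartEdges P p a b) ι) {u w : V}
    (h : (lineAmalgam P p a b ι hab hp).Adj (lineEmb P p a b ι l u) (lineEmb P p a b ι l w)) :
    P.Adj u w := by
  obtain ⟨l', v, v', hvv, hu, hw⟩ := h
  by_cases hu' : p u = a ∨ p u = b
  · by_cases hw' : p w = a ∨ p w = b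
    · have hpv : p u = p v := by
        rw [← linePart_lineEmb hab l u, ← linePart_lineEmb hab l' v, hu]
      have hpw : p w = p v' := by
        rw [← linePart_lineEmb hab l w, ← linePart_lineEmb hab l' v', hw]
      have hne := hp _ _ hvv
      -- At a coordinate that moves on `l`, the two words show `u` and `w`. On `l'` the same
      -- coordinate shows either `v` and `v'` or the two ends of a fixed edge of `P`; these are
      -- adjacent in both cases.
      obtain ⟨j, hj⟩ := l.proper
      rw [lineEmb_inside l hu', lineEmb_inside l' (hpv ▸ hu')] at hu
      rw [lineEmb_inside l hw', lineEmb_inside l' (hpw ▸ hw')] at hw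
      have hu1 := congrFun (Sum.inr_injective hu) j
      have hw1 := congrFun (Sum.inr_injective hw) j
      simp only [hj, Option.elim_none] at hu1 hw1
      cases hj' : l'.idxFun j with
      | none =>
        simp only [hj', Option.elim_none] at hu1 hw1
        rw [hu1, hw1]; exact hvv
      | some e =>
        simp only [hj', Option.elim_some] at hu1 hw1
        have he := e.2.1
        by_cases hva : p v = a
        · have hwa : p v' ≠ a := fun h => hne (hva.trans h.symm)
          rw [if_pos hva] at hu1
          rw [if_neg hwa] at hw1
          rw [hu1, hw1]; exact he
        · have hwa : p v' = a := by
            rcases hpv ▸ hu' with h1 | h1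
            · exact absurd h1 hva
            · rcases hpw ▸ hw' with h2 | h2
              · exact h2
              · exact absurd (h1.trans h2.symm) hne
          rw [if_neg hva] at hu1
          rw [if_pos hwa] at hw1
          rw [hu1, hw1]; exact he.symm
    · obtain ⟨rfl, rfl⟩ := lineEmb_eq_of_outside hab hw' hw
      rw [lineEmb_injective hab l hu]; exact hvv
  · obtain ⟨rfl, rfl⟩ := lineEmb_eq_of_outside hab hu' hu
    rw [lineEmb_injective hab l hw]; exact hvv

/-- The vertices of a clique lie in different parts, so one of at least three vertices is outside
`a` and `b`. That vertex belongs to a single copy, which then contains all its neighbors, and copies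
are induced. -/
theorem cliqueFree_lineAmalgam (hab : a ≠ b) (hp : ∀ u v, P.Adj u v → p u ≠ p v) {m : ℕ}
    (hm : 3 ≤ m) (hP : P.CliqueFree m) : (lineAmalgam P p a b ι hab hp).CliqueFree m := by
  classical
  rw [cliqueFree_iff_isEmpty_hom] at hP ⊢
  refine ⟨fun t => ?_⟩
  have hinj : Function.Injective fun k => linePart P p a b ι (t k) := by
    intro k k' h
    by_contra hne
    exact linePart_ne_of_adj hab hp (t.map_adj (show (⊤ : SimpleGraph (Fin m)).Adj k k' from hne)) h
  obtain ⟨k, hk⟩ : ∃ k, ¬ (linePart P p a b ι (t k) = a ∨ linePart P p a b ι (t k) = b) := by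
    by_contra hall
    push Not at hall
    have h1 : (Finset.univ.image fun k => linePart P p a b ι (t k)) ⊆ {a, b} := by
      intro x hx
      obtain ⟨k, -, rfl⟩ := Finset.mem_image.1 hx
      simpa using hall k
    have h2 := (Finset.card_le_card h1).trans Finset.card_le_two
    rw [Finset.card_image_of_injective _ hinj, Finset.card_univ, Fintype.card_fin] at h2
    omega
  have hne : ∃ k' : Fin m, k' ≠ k := by
    have : Nontrivial (Fin m) := Fin.nontrivial_iff_two_le.2 (by omega)
    exact exists_ne k
  obtain ⟨k', hk'⟩ := hne
  obtain ⟨l, v, -, -, hv, -⟩ :=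
    t.map_adj (show (⊤ : SimpleGraph (Fin m)).Adj k k' from hk'.symm)
  have hvo : ¬ (p v = a ∨ p v = b) := by
    rwa [hv, linePart_lineEmb hab] at hk
  have hr : ∀ q, ∃ w, t q = lineEmb P p a b ι l w := by
    intro q
    by_cases hq : q = k
    · exact ⟨v, hq ▸ hv⟩
    · obtain ⟨l', v', w, -, h1, h2⟩ :=
        t.map_adj (show (⊤ : SimpleGraph (Fin m)).Adj k q from Ne.symm hq)
      obtain ⟨rfl, -⟩ := lineEmb_eq_of_outside hab hvo (hv.symm.trans h1)
      exact ⟨w, h2⟩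
  choose g hg using hr
  refine hP.false ⟨g, fun {q q'} h => ?_⟩
  have := t.map_adj h
  rw [hg, hg] at this
  exact adj_of_lineAmalgam_adj hab hp l this

/-- In the amalgam of a large dimension, the edges from part `a` to part `b` of some copy of `P`
all have the same color. -/
theorem exists_line_mono {r : ℕ} [Finite V] (P : SimpleGraph V) (p : V → I) (hab : a ≠ b) :
    ∃ (ι : Type) (_ : Finite ι), ∀ c : Sym2 ((Combinatorics.Line (PartEdges P p a b) ι × V) ⊕
      (ι → V)) → Fin r, ∃ (l : Combinatorics.Line (PartEdges P p a b) ι) (k : Fin r),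
        ∀ u v, P.Adj u v → p u = a → p v = b →
          c s(lineEmb P p a b ι l u, lineEmb P p a b ι l v) = k := by
  obtain ⟨ι, hι, h⟩ := Combinatorics.Line.exists_mono_in_high_dimension (PartEdges P p a b) (Fin r)
  refine ⟨ι, inferInstance, fun c => ?_⟩
  -- Hales–Jewett over the alphabet of edges from `a` to `b`: a word of edges is an edge between two
  -- words of vertices, and the points of a line are the edges from `a` to `b` of one copy of `P`.
  obtain ⟨l, k, hl⟩ := h fun g => c s(Sum.inr fun j => (g j).1.1, Sum.inr fun j => (g j).1.2)
  refine ⟨l, k, fun u v huv hu hv => ?_⟩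
  rw [← hl ⟨(u, v), huv, hu, hv⟩, lineEmb_inside l (Or.inl hu), lineEmb_inside l (Or.inr hv)]
  congr 2
  · congr 2
    funext j
    rw [Combinatorics.Line.apply_def]
    cases hj : l.idxFun j <;> simp [hj, hu]
  · congr 2
    funext j
    rw [Combinatorics.Line.apply_def]
    have : p v ≠ a := fun h => hab (h.symm.trans hv)
    cases hj : l.idxFun j <;> simp [hj, this]

theorem finite_line (α ι : Type) [Finite α] [Finite ι] : Finite (Combinatorics.Line α ι) :=
  Finite.of_injective (fun l => l.idxFun) fun _ _ h => Combinatorics.Line.ext h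

/-- The partite construction. -/
theorem exists_partite {r m : ℕ} [NeZero r] (hm : 3 ≤ m) {V₀ : Type} [Finite V₀] (P₀ : SimpleGraph V₀)
    (p₀ : V₀ → I) (hp₀ : ∀ u v, P₀.Adj u v → p₀ u ≠ p₀ v) (hP₀ : P₀.CliqueFree m)
    (S : Set (Sym2 I)) (hS : S.Finite) :
    ∃ (V : Type) (_ : Finite V) (P : SimpleGraph V) (p : V → I),
      (∀ u v, P.Adj u v → p u ≠ p v) ∧ P.CliqueFree m ∧
      ∀ c : Sym2 V → Fin r, ∃ h : P₀ →g P, (∀ v, p (h v) = p₀ v) ∧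
        ∀ s ∈ S, ∃ k, ∀ u v, P₀.Adj u v → s(p₀ u, p₀ v) = s → c s(h u, h v) = k := by
  induction S, hS using Set.Finite.induction_on with
  | empty => exact ⟨V₀, inferInstance, P₀, p₀, hp₀, hP₀, fun c => ⟨Hom.id, fun _ => rfl, by simp⟩⟩
  | @insert s S _ _ ih =>
    obtain ⟨V, hV, P, p, hp, hP, hc⟩ := ih
    induction s using Sym2.ind with | _ a b
    by_cases hab : a = b
    · refine ⟨V, hV, P, p, hp, hP, fun c => ?_⟩
      obtain ⟨h, h1, h2⟩ := hc c
      refine ⟨h, h1, fun s hs => ?_⟩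
      rcases hs with rfl | hs
      · by_cases hex : ∃ u v, P₀.Adj u v ∧ s(p₀ u, p₀ v) = s(a, b)
        · obtain ⟨u, v, huv, he⟩ := hex
          exact absurd (by subst hab; simp at he; rw [he.1, he.2]) (hp₀ u v huv)
        · push Not at hex
          -- There are no edges inside a part, so any color serves.
          exact ⟨0, fun u v huv he => absurd he (hex u v huv)⟩
      · exact h2 s hs
    · obtain ⟨ι, hι, hl⟩ := exists_line_mono (r := r) P p hab
      have := finite_line (PartEdges P p a b) ι
      refine ⟨_, inferInstance, lineAmalgam P p a b ι hab hp, linePart P p a b ι,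
        fun u v => linePart_ne_of_adj hab hp, cliqueFree_lineAmalgam hab hp hm hP, fun c => ?_⟩
      obtain ⟨l, k, hk⟩ := hl c
      -- The copy on the line `l` is already monochromatic between `a` and `b`; the induction
      -- hypothesis inside this copy treats the earlier pairs without spoiling that.
      obtain ⟨h, h1, h2⟩ := hc fun e => c (e.map (lineEmb P p a b ι l))
      refine ⟨⟨fun v => lineEmb P p a b ι l (h v), fun {u v} huv =>
        ⟨l, h u, h v, h.map_adj huv, rfl, rfl⟩⟩, fun v => ?_, fun s hs => ?_⟩
      · exact (linePart_lineEmb hab l (h v)).trans (h1 v)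
      · rcases hs with rfl | hs
        · refine ⟨k, fun u v huv he => ?_⟩
          rcases Sym2.eq_iff.1 he with ⟨hu, hv⟩ | ⟨hu, hv⟩
          · exact hk _ _ (h.map_adj huv) ((h1 u).trans hu) ((h1 v).trans hv)
          · rw [Sym2.eq_swap]
            exact hk _ _ (h.map_adj huv.symm) ((h1 v).trans hv) ((h1 u).trans hu)
        · exact h2 s hs

/-- The Folkman-type theorem of Nešetřil and Rödl: for every `K_m`-free finite graph `B` there is a
`K_m`-free finite graph `G` such that every coloring of its edges has a monochromatic `B`. -/
theorem exists_cliqueFree_arrow {r m : ℕ} [NeZero r] (hm : 3 ≤ m) {β : Type} [Finite β]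
    (B : SimpleGraph β) (hB : B.CliqueFree m) :
    ∃ (V : Type) (_ : Finite V) (G : SimpleGraph V), G.CliqueFree m ∧
      ∀ c : Sym2 V → Fin r, ∃ (h : B →g G) (k : Fin r), ∀ u v, B.Adj u v → c s(h u, h v) = k := by
  classical
  obtain ⟨N, hN⟩ := exists_ramsey r β
  -- One disjoint copy of `B` for every injection `σ` into the `N` parts. Once colors depend only on
  -- the pair of parts, Ramsey's theorem chooses the `σ` whose copy is monochromatic.
  let P₀ : SimpleGraph ((β ↪ Fin N) × β) :=
    { Adj := fun x y => x.1 = y.1 ∧ B.Adj x.2 y.2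
      symm := ⟨fun _ _ h => ⟨h.1.symm, h.2.symm⟩⟩
      loopless := ⟨fun _ h => h.2.ne rfl⟩ }
  have hP₀ : P₀.CliqueFree m := CliqueFree.of_hom (⟨Prod.snd, fun h => h.2⟩ : P₀ →g B) hB
  obtain ⟨V, hV, G, p, -, hG, hc⟩ := exists_partite (r := r) hm P₀ (fun x => x.1 x.2)
    (fun u v h he => h.2.ne (u.1.injective (by rw [he, h.1]))) hP₀ Set.univ Set.finite_univ
  refine ⟨V, hV, G, hG, fun c => ?_⟩
  obtain ⟨h, -, hk⟩ := hc c
  choose χ hχ using fun s => hk s (Set.mem_univ s)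
  obtain ⟨σ, k, hσ⟩ := hN χ
  refine ⟨⟨fun v => h (σ, v), fun {u v} huv => h.map_adj (show P₀.Adj (σ, u) (σ, v) from
    ⟨rfl, huv⟩)⟩, k, fun u v huv => ?_⟩
  exact (hχ _ (σ, u) (σ, v) ⟨rfl, huv⟩ rfl).trans (hσ u v huv.ne)

end Partite

end EdgeCol

namespace EdgeCol

/-! ### Odd closed walks in unions of graphs -/

section Walks

variable {V W : Type*} {G A B : SimpleGraph V} {u v w x y : V} {l n : ℕ}

/-- There is a walk of length `l` from `u` to `v`. -/
def HasWalk (G : SimpleGraph V) (l : ℕ) (u v : V) : Prop := ∃ w : G.Walk u v, w.length = l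

/-- There is no closed walk of odd length at most `n`. -/
def OddWalkFree (G : SimpleGraph V) (n : ℕ) : Prop :=
  ∀ u l, Odd l → l ≤ n → ¬ HasWalk G l u u

theorem HasWalk.zero (G : SimpleGraph V) (u : V) : HasWalk G 0 u u := ⟨.nil, rfl⟩

theorem HasWalk.eq_of_zero (h : HasWalk G 0 u v) : u = v := by
  obtain ⟨w, hw⟩ := h
  exact Walk.eq_of_length_eq_zero hw

theorem hasWalk_one : HasWalk G 1 u v ↔ G.Adj u v :=
  ⟨fun ⟨_, hw⟩ => Walk.adj_of_length_eq_one hw, fun h => ⟨h.toWalk, by simp⟩⟩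

theorem HasWalk.symm (h : HasWalk G l u v) : HasWalk G l v u := by
  obtain ⟨w, hw⟩ := h
  exact ⟨w.reverse, by simpa using hw⟩

theorem HasWalk.trans {k : ℕ} (h : HasWalk G l u v) (h' : HasWalk G k v w) :
    HasWalk G (l + k) u w := by
  obtain ⟨p, rfl⟩ := h
  obtain ⟨q, rfl⟩ := h'
  exact ⟨p.append q, by simp⟩

theorem HasWalk.map {H : SimpleGraph W} (f : G →g H) (h : HasWalk G l u v) :
    HasWalk H l (f u) (f v) := by
  obtain ⟨p, rfl⟩ := h
  exact ⟨p.map f, by simp⟩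

theorem HasWalk.exists_adj_left (h : HasWalk G l u v) (hl : l ≠ 0) : ∃ z, G.Adj u z := by
  obtain ⟨p, rfl⟩ := h
  cases p with
  | nil => simp at hl
  | cons h _ => exact ⟨_, h⟩

theorem HasWalk.pad (h : HasWalk G l u u) (hl : l ≠ 0) (k : ℕ) : HasWalk G (l + 2 * k) u u := by
  obtain ⟨z, hz⟩ := h.exists_adj_left hl
  induction k with
  | zero => exact h
  | succ k ih => exact ih.trans ((hasWalk_one.2 hz).trans (hasWalk_one.2 hz.symm))

/-- A function that changes by at most one along edges bounds the length of walks. -/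
theorem HasWalk.le_add (φ : V → ℕ) (hφ : ∀ u v, G.Adj u v → φ v ≤ φ u + 1) (h : HasWalk G l u v) :
    φ v ≤ φ u + l := by
  obtain ⟨p, rfl⟩ := h
  induction p with
  | nil => simp
  | cons h p ih =>
    have := hφ _ _ h
    simp only [Walk.length_cons]
    omega

/-- The parity of a function that changes parity along every edge gives the parity of walks. -/
theorem HasWalk.even_iff (φ : V → ℕ) (hφ : ∀ u v, G.Adj u v → (Even (φ u) ↔ ¬ Even (φ v)))
    (h : HasWalk G l u v) : Even l ↔ (Even (φ u) ↔ Even (φ v)) := by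
  obtain ⟨p, rfl⟩ := h
  induction p with
  | nil => simp
  | cons h p ih =>
    have := hφ _ _ h
    simp only [Walk.length_cons, Nat.even_add_one]
    tauto

theorem hasWalk_of_hom_cycleGraph (hn : 3 ≤ n) (f : cycleGraph n →g G) : ∃ u, HasWalk G n u u := by
  obtain ⟨k, rfl⟩ : ∃ k, n = k + 3 := ⟨n - 3, by omega⟩
  exact ⟨_, HasWalk.map f ⟨cycleGraph.cycle k, cycleGraph.length_cycle⟩⟩

theorem nonempty_hom_cycleGraph (hn : 2 ≤ n) (h : HasWalk G n u u) :
    Nonempty (cycleGraph n →g G) := by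
  obtain ⟨p, hp⟩ := h
  obtain ⟨n, rfl⟩ : ∃ k, n = k + 2 := ⟨n - 2, by omega⟩
  have key : ∀ a b : Fin (n + 2), a - b = 1 → G.Adj (p.getVert a) (p.getVert b) := by
    intro a b hab
    obtain rfl : a = b + 1 := by rw [← hab]; abel
    by_cases hb : b = Fin.last _
    · subst hb
      have h1 := p.adj_getVert_succ (i := n + 1) (by omega)
      have h2 : p.getVert (n + 1 + 1) = p.getVert 0 := by
        rw [← hp, Walk.getVert_length, Walk.getVert_zero]
      rw [h2] at h1
      simpa using h1.symm
    · have h1 := p.adj_getVert_succ (i := b) (by omega)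
      have h2 : ((b + 1 : Fin (n + 2)) : ℕ) = b + 1 :=
        Fin.val_add_one_of_lt (Fin.lt_last_iff_ne_last.2 hb)
      rw [h2]; exact h1.symm
  refine ⟨⟨fun k => p.getVert k, fun {a b} hab => ?_⟩⟩
  rcases cycleGraph_adj.1 hab with h | h
  · exact key _ _ h
  · exact (key _ _ h).symm

theorem OddWalkFree.mono {k : ℕ} (hk : k ≤ n) (h : OddWalkFree G n) : OddWalkFree G k :=
  fun u l hl hlk => h u l hl (hlk.trans hk)

/-- A shorter odd closed walk reaches length `n` by going back and forth along an edge, and a closed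
walk of length `n` is an image of the cycle. -/
theorem oddWalkFree_of_isEmpty_hom (hn : Odd n) (hn2 : 2 ≤ n) (h : IsEmpty (cycleGraph n →g G)) :
    OddWalkFree G n := by
  intro u l hl hln hw
  obtain ⟨k, hk⟩ : ∃ k, n = l + 2 * k := by
    obtain ⟨a, rfl⟩ := hn
    obtain ⟨b, rfl⟩ := hl
    exact ⟨a - b, by omega⟩
  have := hw.pad (by rintro rfl; simp at hl) k
  rw [← hk] at this
  exact (not_nonempty_iff.2 h) (nonempty_hom_cycleGraph hn2 this)

theorem OddWalkFree.isEmpty_hom (hn : Odd n) (hn3 : 3 ≤ n) (h : OddWalkFree G n) :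
    IsEmpty (cycleGraph n →g G) :=
  ⟨fun f => by
    obtain ⟨u, hu⟩ := hasWalk_of_hom_cycleGraph hn3 f
    exact h u n hn le_rfl hu⟩

/-- A walk in the union of two graphs lies in one of them or passes through a common vertex. -/
theorem hasWalk_sup {T : Set V} (hT : ∀ z u v, A.Adj z u → B.Adj z v → z ∈ T)
    (h : HasWalk (A ⊔ B) l u v) : HasWalk A l u v ∨ HasWalk B l u v ∨ ∃ t ∈ T, ∃ p q, 0 < p ∧
      0 < q ∧ p + q = l ∧ HasWalk (A ⊔ B) p u t ∧ HasWalk (A ⊔ B) q t v := by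
  obtain ⟨w, rfl⟩ := h
  induction w with
  | nil => exact Or.inl (HasWalk.zero _ _)
  | @cons u z v h w ih =>
    have hw : HasWalk (A ⊔ B) w.length z v := ⟨w, rfl⟩
    rw [Walk.length_cons, add_comm]
    by_cases h0 : w.length = 0
    · rw [h0] at hw ⊢
      obtain rfl := hw.eq_of_zero
      rcases h with h | h
      · exact Or.inl (hasWalk_one.2 h)
      · exact Or.inr (Or.inl (hasWalk_one.2 h))
    have h1 : HasWalk (A ⊔ B) 1 u z := hasWalk_one.2 h
    rcases ih with hA | hB | ⟨t, ht, p, q, hp, hq, hpq, hp', hq'⟩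
    · rcases h with h | h
      · exact Or.inl ((hasWalk_one.2 h).trans hA)
      · obtain ⟨a, ha⟩ := hA.exists_adj_left h0
        exact Or.inr (Or.inr ⟨z, hT _ _ _ ha h.symm, 1, _, one_pos, Nat.pos_of_ne_zero h0, rfl,
          h1, hw⟩)
    · rcases h with h | h
      · obtain ⟨a, ha⟩ := hB.exists_adj_left h0
        exact Or.inr (Or.inr ⟨z, hT _ _ _ h.symm ha, 1, _, one_pos, Nat.pos_of_ne_zero h0, rfl,
          h1, hw⟩)
      · exact Or.inr (Or.inl ((hasWalk_one.2 h).trans hB))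
    · exact Or.inr (Or.inr ⟨t, ht, 1 + p, q, by omega, hq, by omega, h1.trans hp', hq'⟩)

/-- To exclude short odd closed walks in the union of two graphs, it suffices to look at those that
start in a common vertex. -/
theorem oddWalkFree_sup_of_common {T : Set V} (hT : ∀ z u v, A.Adj z u → B.Adj z v → z ∈ T)
    (hA : OddWalkFree A n) (hB : OddWalkFree B n)
    (h : ∀ t ∈ T, ∀ l ≤ n, HasWalk (A ⊔ B) l t t → Even l) : OddWalkFree (A ⊔ B) n := by
  intro u l hl hln hw
  rcases hasWalk_sup hT hw with h' | h' | ⟨t, ht, p, q, hp, hq, hpq, hp', hq'⟩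
  · exact hA u l hl hln h'
  · exact hB u l hl hln h'
  · have := h t ht (q + p) (by omega) (hq'.trans hp')
    rw [add_comm, hpq] at this
    exact Nat.not_even_iff_odd.2 hl this

/-- Gluing along the ends of an edge does not create short odd closed walks, if a walk on one side
and a walk on the other side between the two ends do not combine to one. -/
theorem oddWalkFree_sup (hT : ∀ z u v, A.Adj z u → B.Adj z v → z = x ∨ z = y)
    (hA : OddWalkFree A n) (hB : OddWalkFree B n)
    (h : ∀ p q, p + q ≤ n → HasWalk A p x y → HasWalk B q x y → Even (p + q)) :
    OddWalkFree (A ⊔ B) n := by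
  have hT' : ∀ z u v, A.Adj z u → B.Adj z v → z ∈ ({x, y} : Set V) := hT
  -- Strengthened for induction on the length: a walk between different terminals can be traded for
  -- one of the same parity, no longer, that stays on one side.
  have key : ∀ l ≤ n, ∀ t ∈ ({x, y} : Set V), ∀ t' ∈ ({x, y} : Set V), HasWalk (A ⊔ B) l t t' →
      (t = t' → Even l) ∧ (t ≠ t' → ∃ p ≤ l, (Even p ↔ Even l) ∧
        (HasWalk A p x y ∨ HasWalk B p x y)) := by
    intro l
    induction l using Nat.strong_induction_on with
    | _ l ih =>
    intro hl t ht t' ht' hw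
    have orient : ∀ {C : SimpleGraph V}, t ≠ t' → HasWalk C l t t' → HasWalk C l x y := by
      intro C hne hC
      rcases ht with rfl | rfl <;> rcases ht' with rfl | rfl
      · exact absurd rfl hne
      · exact hC
      · exact hC.symm
      · exact absurd rfl hne
    rcases hasWalk_sup hT' hw with h' | h' | ⟨s, hs, p, q, hp, hq, hpq, hp', hq'⟩
    · refine ⟨?_, fun hne => ⟨l, le_rfl, Iff.rfl, Or.inl (orient hne h')⟩⟩
      rintro rfl
      by_contra hodd
      exact hA t l (Nat.not_even_iff_odd.1 hodd) hl h'
    · refine ⟨?_, fun hne => ⟨l, le_rfl, Iff.rfl, Or.inr (orient hne h')⟩⟩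
      rintro rfl
      by_contra hodd
      exact hB t l (Nat.not_even_iff_odd.1 hodd) hl h'
    · have h1 := ih p (by omega) (by omega) t ht s hs hp'
      have h2 := ih q (by omega) (by omega) s hs t' ht' hq'
      subst hpq
      by_cases hts : t = s
      · subst hts
        have hpe := h1.1 rfl
        refine ⟨fun e => Nat.even_add.2 ⟨fun _ => h2.1 e, fun _ => hpe⟩, fun hne => ?_⟩
        obtain ⟨k, hk, hke, hk'⟩ := h2.2 hne
        exact ⟨k, by omega, by simp [hke, Nat.even_add, hpe], hk'⟩
      by_cases hst : s = t'
      · subst hst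
        have hqe := h2.1 rfl
        refine ⟨fun e => absurd e hts, fun hne => ?_⟩
        obtain ⟨k, hk, hke, hk'⟩ := h1.2 hne
        exact ⟨k, by omega, by simp [hke, Nat.even_add, hqe], hk'⟩
      · obtain ⟨a, ha, hae, ha'⟩ := h1.2 hts
        obtain ⟨b, hb, hbe, hb'⟩ := h2.2 hst
        have hev : Even (a + b) := by
          rcases ha' with ha' | ha' <;> rcases hb' with hb' | hb'
          · by_contra hodd
            exact hA x _ (Nat.not_even_iff_odd.1 hodd) (by omega) (ha'.trans hb'.symm)
          · exact h _ _ (by omega) ha' hb'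
          · rw [add_comm]; exact h _ _ (by omega) hb' ha'
          · by_contra hodd
            exact hB x _ (Nat.not_even_iff_odd.1 hodd) (by omega) (ha'.trans hb'.symm)
        rw [Nat.even_add] at hev
        refine ⟨fun _ => by rw [Nat.even_add, ← hae, ← hbe]; exact hev, fun hne => ?_⟩
        have htt : t = t' := by
          clear * - ht hs ht' hts hst
          simp only [Set.mem_insert_iff, Set.mem_singleton_iff] at ht hs ht'
          grind
        exact absurd htt hne
  exact oddWalkFree_sup_of_common hT' hA hB fun t ht l hl hw => (key l hl t ht t ht hw).1 rfl

/-- Attaching a graph in which the common vertices are far apart does not create short odd closed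
walks. -/
theorem oddWalkFree_sup_of_far {T : Set V} (hT : ∀ z u v, A.Adj z u → B.Adj z v → z ∈ T)
    (hA : OddWalkFree A n) (hB : OddWalkFree B n)
    (h : ∀ t ∈ T, ∀ t' ∈ T, ∀ l ≤ n, HasWalk B l t t' → t = t') : OddWalkFree (A ⊔ B) n := by
  -- A short excursion into `B` returns to its starting point and has even length, so it can be cut
  -- out without changing the parity.
  have key : ∀ l ≤ n, ∀ t ∈ T, ∀ t' ∈ T, HasWalk (A ⊔ B) l t t' →
      ∃ p ≤ l, (Even p ↔ Even l) ∧ HasWalk A p t t' := by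
    intro l
    induction l using Nat.strong_induction_on with
    | _ l ih =>
    intro hl t ht t' ht' hw
    rcases hasWalk_sup hT hw with h' | h' | ⟨s, hs, p, q, hp, hq, hpq, hp', hq'⟩
    · exact ⟨l, le_rfl, Iff.rfl, h'⟩
    · obtain rfl := h t ht t' ht' l hl h'
      have hev : Even l := by
        by_contra hodd
        exact hB t l (Nat.not_even_iff_odd.1 hodd) hl h'
      exact ⟨0, Nat.zero_le _, by simpa using hev, HasWalk.zero _ _⟩
    · obtain ⟨a, ha, hae, ha'⟩ := ih p (by omega) (by omega) t ht s hs hp'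
      obtain ⟨b, hb, hbe, hb'⟩ := ih q (by omega) (by omega) s hs t' ht' hq'
      exact ⟨a + b, by omega, by rw [← hpq, Nat.even_add, Nat.even_add, hae, hbe], ha'.trans hb'⟩
  refine oddWalkFree_sup_of_common hT hA hB fun t ht l hl hw => ?_
  obtain ⟨p, hp, hpe, hp'⟩ := key l hl t ht t ht hw
  by_contra hodd
  exact hA t p (Nat.not_even_iff_odd.1 (hpe.not.2 hodd)) (by omega) hp'

/-- A walk between the two common vertices of two graphs can be replaced by a walk in one of
them. -/
theorem exists_hasWalk_of_sup (hT : ∀ z u v, A.Adj z u → B.Adj z v → z = x ∨ z = y)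
    (h : HasWalk (A ⊔ B) l x y) : ∃ p ≤ l, HasWalk A p x y ∨ HasWalk B p x y := by
  induction l using Nat.strong_induction_on with
  | _ l ih =>
  rcases hasWalk_sup (T := {x, y}) hT h with h' | h' | ⟨s, hs, p, q, hp, hq, hpq, hp', hq'⟩
  · exact ⟨l, le_rfl, Or.inl h'⟩
  · exact ⟨l, le_rfl, Or.inr h'⟩
  · rcases hs with rfl | rfl
    · obtain ⟨k, hk, hk'⟩ := ih q (by omega) hq'
      exact ⟨k, by omega, hk'⟩
    · obtain ⟨k, hk, hk'⟩ := ih p (by omega) hp'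
      exact ⟨k, by omega, hk'⟩

end Walks

end EdgeCol

/-! ### Freeness in terms of color classes -/

namespace EdgeCol

variable {r m : ℕ} {F : Set (FinColoredGraph r)} {A : FinColoredGraph r} {i j c : Fin r}
  {V W : Type} {G : SimpleGraph V} {H : SimpleGraph W}

/-- A member of the family is a clique or a monochromatic odd cycle. -/
theorem IsCycleCliqueFamily.cases (hF : IsCycleCliqueFamily m F) (hA : A ∈ F) :
    (A.graph = ⊤ ∧ 3 ≤ Nat.card A.V) ∨
    (A.graph ≠ ⊤ ∧ Odd (Nat.card A.V) ∧ 3 ≤ Nat.card A.V ∧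
      Nonempty (A.graph ≃g cycleGraph (Nat.card A.V)) ∧ ∃ i, A.MonoOf i) := by
  by_cases hT : A.graph = ⊤
  · refine Or.inl ⟨hT, ?_⟩
    rcases hF.shape A hA with ⟨n, hn, -, ⟨φ⟩⟩ | ⟨n, hn, hc, -⟩
    · rwa [Nat.card_congr φ.toEquiv, Nat.card_fin]
    · rwa [hc]
  · rcases hF.shape A hA with h | ⟨n, hn, -, h⟩
    · obtain ⟨i, hi⟩ := hF.cycle_mono A hA h hT
      obtain ⟨n, hn, hodd, ⟨φ⟩⟩ := h
      have hc : Nat.card A.V = n := by rw [Nat.card_congr φ.toEquiv, Nat.card_fin]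
      rw [hc]
      exact Or.inr ⟨hT, hodd, hn, ⟨φ⟩, i, hi⟩
    · exact absurd h hT

theorem IsCycleCliqueFamily.exists_adj (hF : IsCycleCliqueFamily m F) (hA : A ∈ F) :
    ∃ u v, A.graph.Adj u v := by
  rcases hF.cases hA with ⟨h, hc⟩ | ⟨-, -, hc, ⟨φ⟩, -⟩
  · have := A.fin
    have : Nontrivial A.V := Finite.one_lt_card_iff_nontrivial.1 (by omega)
    obtain ⟨u, v, huv⟩ := exists_pair_ne A.V
    exact ⟨u, v, by rw [h]; exact huv⟩
  · obtain ⟨k, hk⟩ : ∃ k, Nat.card A.V = k + 3 := ⟨Nat.card A.V - 3, by omega⟩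
    rw [hk] at φ
    exact ⟨φ.symm 0, φ.symm 1, φ.symm.map_adj_iff.2 (by rw [cycleGraph_adj]; simp)⟩

theorem mono_hom_iff (hi : A.MonoOf i) (γ : G.EdgeLabeling (Fin r)) :
    (∃ h : A.graph →g G, ∀ e, γ (h.mapEdgeSet e) = A.color e) ↔
      Nonempty (A.graph →g γ.labelGraph i) := by
  constructor
  · rintro ⟨h, hh⟩
    exact ⟨⟨h, fun {a b} hab => (EdgeLabeling.labelGraph_adj _ _).2
      ⟨h.map_adj hab, (hh ⟨s(a, b), hab⟩).trans (hi _)⟩⟩⟩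
  · rintro ⟨h⟩
    refine ⟨(Hom.ofLE γ.labelGraph_le).comp h, ?_⟩
    rintro ⟨e, he⟩
    induction e using Sym2.ind with | _ a b
    obtain ⟨h1, h2⟩ := (EdgeLabeling.labelGraph_adj _ _).1 (h.map_adj he)
    rw [hi]
    exact h2

theorem IsFree.isEmpty_hom {γ : G.EdgeLabeling (Fin r)} (h : IsFree F G γ) (hA : A ∈ F)
    (hi : A.MonoOf i) : IsEmpty (A.graph →g γ.labelGraph i) := by
  rw [← not_nonempty_iff, ← mono_hom_iff hi]
  exact h A hA

theorem mapEdgeSet_comp {U V W : Type*} {G₁ : SimpleGraph U} {G₂ : SimpleGraph V}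
    {G₃ : SimpleGraph W} (f : G₂ →g G₃) (g : G₁ →g G₂) (e : G₁.edgeSet) :
    (f.comp g).mapEdgeSet e = f.mapEdgeSet (g.mapEdgeSet e) :=
  Subtype.ext (Sym2.map_map (g := f) (f := g) e.1).symm

theorem IsFree.pullback {γ : H.EdgeLabeling (Fin r)} (h : IsFree F H γ) (f : G →g H) :
    IsFree F G (γ.pullback f) := by
  rintro A hA ⟨g, hg⟩
  exact h A hA ⟨f.comp g, fun e => by rw [mapEdgeSet_comp]; exact hg e⟩

/-- In a `K_m`-free graph, only the monochromatic members of the family matter. -/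
theorem isFree_of_cliqueFree (hF : IsCycleCliqueFamily m F) (hG : G.CliqueFree m)
    {γ : G.EdgeLabeling (Fin r)}
    (h : ∀ A ∈ F, ∀ i, A.MonoOf i → IsEmpty (A.graph →g γ.labelGraph i)) : IsFree F G γ := by
  rintro A hA ⟨f, hf⟩
  by_cases hmono : A.Mono
  · obtain ⟨i, hi⟩ := hmono
    exact not_nonempty_iff.2 (h A hA i hi) ((mono_hom_iff hi γ).1 ⟨f, hf⟩)
  · rcases hF.cases hA with ⟨hT, -⟩ | ⟨-, -, -, -, hi⟩
    · have hm := hF.le_of_not_mono A hA hmono _ ⟨rfl, hT⟩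
      have := A.fin
      have := Fintype.ofFinite A.V
      rw [Nat.card_eq_fintype_card] at hm
      obtain ⟨g⟩ : Nonempty (Fin m ↪ A.V) :=
        Function.Embedding.nonempty_of_card_le (by simpa using hm)
      refine (cliqueFree_iff_isEmpty_hom.1 hG).false
        (f.comp ⟨g, fun {a b} hab => ?_⟩)
      rw [hT]
      exact g.injective.ne hab
    · exact hmono hi

theorem IsFree.oddWalkFree (hF : IsCycleCliqueFamily m F) {γ : G.EdgeLabeling (Fin r)}
    (h : IsFree F G γ) (hA : A ∈ F) (hi : A.MonoOf i) (hT : A.graph ≠ ⊤) :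
    OddWalkFree (γ.labelGraph i) (Nat.card A.V) := by
  rcases hF.cases hA with ⟨hT', -⟩ | ⟨-, hodd, h3, ⟨φ⟩, -⟩
  · exact absurd hT' hT
  · exact oddWalkFree_of_isEmpty_hom hodd (by omega)
      ⟨fun f => (h.isEmpty_hom hA hi).false (f.comp φ.toHom)⟩

theorem isFree_bot (hF : IsCycleCliqueFamily m F) (γ : (⊥ : SimpleGraph V).EdgeLabeling (Fin r)) :
    IsFree F ⊥ γ := by
  rintro A hA ⟨f, -⟩
  obtain ⟨u, v, huv⟩ := hF.exists_adj hA
  exact f.map_adj huv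

/-! ### Gluing along an edge -/

section Glue

variable {d : G.Dart} {f : H.Dart} {K : Type*}

theorem glueRight_fst : glueRight d f f.fst = Sum.inl d.fst := by
  simp [glueRight]

theorem glueRight_snd : glueRight d f f.snd = Sum.inl d.snd := by
  simp [glueRight, f.adj.ne.symm]

theorem glueRight_eq_inl {w : W} {v : V} (h : glueRight d f w = Sum.inl v) :
    (w = f.fst ∧ v = d.fst) ∨ (w = f.snd ∧ v = d.snd) := by
  unfold glueRight at h
  split_ifs at h with h1 h2
  · exact Or.inl ⟨h1, (Sum.inl_injective h).symm⟩
  · exact Or.inr ⟨h2, (Sum.inl_injective h).symm⟩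

theorem glueRight_of_inr (z : {w : W // w ≠ f.fst ∧ w ≠ f.snd}) :
    glueRight d f z = Sum.inr z := by
  simp [glueRight, z.2.1, z.2.2]

/-- An edge of `H` between the two shared vertices can only be `f`, which is identified with an edge
of `G`. So the copy of `G` gains no edges. -/
theorem glueInl_adj {u v : V} (h : (glue d f).Adj (Sum.inl u) (Sum.inl v)) : G.Adj u v := by
  rcases h with ⟨u', v', h, h1, h2⟩ | ⟨u', v', h, h1, h2⟩
  · rwa [Sum.inl_injective h1, Sum.inl_injective h2]
  · rcases glueRight_eq_inl h1.symm with ⟨rfl, rfl⟩ | ⟨rfl, rfl⟩ <;>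
      rcases glueRight_eq_inl h2.symm with ⟨rfl, rfl⟩ | ⟨rfl, rfl⟩
    · exact absurd rfl h.ne
    · exact d.adj
    · exact d.adj.symm
    · exact absurd rfl h.ne

theorem glueRight_adj {u v : W} (h : (glue d f).Adj (glueRight d f u) (glueRight d f v)) :
    H.Adj u v := by
  rcases h with ⟨u', v', h, h1, h2⟩ | ⟨u', v', h, h1, h2⟩
  · rcases glueRight_eq_inl h1 with ⟨rfl, rfl⟩ | ⟨rfl, rfl⟩ <;>
      rcases glueRight_eq_inl h2 with ⟨rfl, rfl⟩ | ⟨rfl, rfl⟩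
    · exact absurd rfl h.ne
    · exact f.adj
    · exact f.adj.symm
    · exact absurd rfl h.ne
  · rwa [glueRight_injective d f h1, glueRight_injective d f h2]

theorem exists_of_mem_glue (e : (glue d f).edgeSet) :
    (∃ e', (glueInl d f).mapEdgeSet e' = e) ∨ ∃ e', (glueInr d f).mapEdgeSet e' = e := by
  rcases e with ⟨e, he⟩
  induction e using Sym2.ind with | _ a b
  have hab : (glue d f).Adj a b := he
  rcases hab with ⟨u, v, h, h1, h2⟩ | ⟨u, v, h, h1, h2⟩
  · exact Or.inl ⟨⟨s(u, v), h⟩, Subtype.ext (congrArg₂ (fun x y => s(x, y)) h1 h2).symm⟩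
  · exact Or.inr ⟨⟨s(u, v), h⟩, Subtype.ext (congrArg₂ (fun x y => s(x, y)) h1 h2).symm⟩

theorem glueInl_mapEdgeSet_injective : Function.Injective (glueInl d f).mapEdgeSet :=
  Hom.mapEdgeSet.injective _ Sum.inl_injective

theorem glueInr_mapEdgeSet_injective : Function.Injective (glueInr d f).mapEdgeSet :=
  Hom.mapEdgeSet.injective _ (glueRight_injective d f)

theorem glueInl_mapEdgeSet_dart : (glueInl d f).mapEdgeSet ⟨d.edge, d.edge_mem⟩ =
    (glueInr d f).mapEdgeSet ⟨f.edge, f.edge_mem⟩ := by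
  apply Subtype.ext
  change s(Sum.inl d.fst, Sum.inl d.snd) = s(glueRight d f f.fst, glueRight d f f.snd)
  rw [glueRight_fst, glueRight_snd]

theorem eq_dart_of_glue_eq {e : G.edgeSet} {e' : H.edgeSet}
    (h : (glueInl d f).mapEdgeSet e = (glueInr d f).mapEdgeSet e') :
    e = ⟨d.edge, d.edge_mem⟩ ∧ e' = ⟨f.edge, f.edge_mem⟩ := by
  have key : e' = ⟨f.edge, f.edge_mem⟩ := by
    rcases e with ⟨e, he⟩
    rcases e' with ⟨e', he'⟩
    induction e using Sym2.ind with | _ u v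
    induction e' using Sym2.ind with | _ w z
    have h' : s((Sum.inl u : GlueVert d f), Sum.inl v) = s(glueRight d f w, glueRight d f z) :=
      congrArg Subtype.val h
    have h1 : ∃ a, glueRight d f w = Sum.inl a := by
      rcases Sym2.eq_iff.1 h' with ⟨h1, h2⟩ | ⟨h1, h2⟩
      exacts [⟨_, h1.symm⟩, ⟨_, h2.symm⟩]
    have h2 : ∃ a, glueRight d f z = Sum.inl a := by
      rcases Sym2.eq_iff.1 h' with ⟨h1, h2⟩ | ⟨h1, h2⟩
      exacts [⟨_, h2.symm⟩, ⟨_, h1.symm⟩]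
    obtain ⟨a, h1⟩ := h1
    obtain ⟨b, h2⟩ := h2
    have hne : w ≠ z := SimpleGraph.Adj.ne he'
    apply Subtype.ext
    rcases glueRight_eq_inl h1 with ⟨rfl, -⟩ | ⟨rfl, -⟩ <;>
      rcases glueRight_eq_inl h2 with ⟨rfl, -⟩ | ⟨rfl, -⟩
    · exact absurd rfl hne
    · rfl
    · exact Sym2.eq_swap
    · exact absurd rfl hne
  refine ⟨glueInl_mapEdgeSet_injective (h.trans ?_), key⟩
  rw [key, glueInl_mapEdgeSet_dart]

open Classical in
/-- The labeling of the glued graph given by labelings of its two parts. -/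
noncomputable def glueLabel (d : G.Dart) (f : H.Dart) (a : G.EdgeLabeling K)
    (b : H.EdgeLabeling K) : (glue d f).EdgeLabeling K := fun e =>
  if h : ∃ e', (glueInl d f).mapEdgeSet e' = e then a h.choose
  else b ((exists_of_mem_glue e).resolve_left h).choose

theorem glueLabel_inl (a : G.EdgeLabeling K) (b : H.EdgeLabeling K) (e : G.edgeSet) :
    glueLabel d f a b ((glueInl d f).mapEdgeSet e) = a e := by
  have h : ∃ e', (glueInl d f).mapEdgeSet e' = (glueInl d f).mapEdgeSet e := ⟨e, rfl⟩
  rw [glueLabel, dif_pos h, glueInl_mapEdgeSet_injective h.choose_spec]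

theorem glueLabel_inr {a : G.EdgeLabeling K} {b : H.EdgeLabeling K}
    (hab : a ⟨d.edge, d.edge_mem⟩ = b ⟨f.edge, f.edge_mem⟩) (e : H.edgeSet) :
    glueLabel d f a b ((glueInr d f).mapEdgeSet e) = b e := by
  by_cases h : ∃ e', (glueInl d f).mapEdgeSet e' = (glueInr d f).mapEdgeSet e
  · obtain ⟨h1, h2⟩ := eq_dart_of_glue_eq h.choose_spec
    rw [glueLabel, dif_pos h, h1, hab, ← h2]
  · have h' : ∃ e', (glueInr d f).mapEdgeSet e' = (glueInr d f).mapEdgeSet e := ⟨e, rfl⟩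
    rw [glueLabel, dif_neg h]
    exact congrArg b (glueInr_mapEdgeSet_injective h'.choose_spec)

theorem labelGraph_glueLabel_le {a : G.EdgeLabeling K} {b : H.EdgeLabeling K}
    (hab : a ⟨d.edge, d.edge_mem⟩ = b ⟨f.edge, f.edge_mem⟩) (k : K) :
    (glueLabel d f a b).labelGraph k ≤
      (a.labelGraph k).map Sum.inl ⊔ (b.labelGraph k).map (glueRight d f) := by
  intro x y hxy
  obtain ⟨h, hk⟩ := (EdgeLabeling.labelGraph_adj _ _).1 hxy
  rcases h with ⟨u, v, h, rfl, rfl⟩ | ⟨u, v, h, rfl, rfl⟩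
  · left
    have : a ⟨s(u, v), h⟩ = k := by rw [← hk]; exact (glueLabel_inl a b ⟨s(u, v), h⟩).symm
    exact map_adj_apply' ((EdgeLabeling.labelGraph_adj _ _).2 ⟨h, this⟩)
      (Sum.inl_injective.ne h.ne)
  · right
    have : b ⟨s(u, v), h⟩ = k := by rw [← hk]; exact (glueLabel_inr hab ⟨s(u, v), h⟩).symm
    exact map_adj_apply' ((EdgeLabeling.labelGraph_adj _ _).2 ⟨h, this⟩)
      ((glueRight_injective d f).ne h.ne)

/-- The two parts of the glued graph meet only in the ends of the edge. -/
theorem glue_common (A : SimpleGraph V) (B : SimpleGraph W) {z u v : GlueVert d f}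
    (hu : (A.map Sum.inl).Adj z u) (hv : (B.map (glueRight d f)).Adj z v) :
    z = Sum.inl d.fst ∨ z = Sum.inl d.snd := by
  obtain ⟨-, a, b, -, rfl, -⟩ := hu
  obtain ⟨-, a', b', -, h, -⟩ := hv
  rcases glueRight_eq_inl h with ⟨-, rfl⟩ | ⟨-, rfl⟩
  · exact Or.inl rfl
  · exact Or.inr rfl

end Glue

theorem HasWalk.mono {G' : SimpleGraph V} {l : ℕ} {u v : V} (hle : G ≤ G') (h : HasWalk G l u v) :
    HasWalk G' l u v := by
  simpa using h.map (Hom.ofLE hle)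

theorem HasWalk.exists_of_map {g : V → W} (hg : Function.Injective g) {l : ℕ} {u : V} {y : W}
    (h : HasWalk (G.map g) l (g u) y) : ∃ v, y = g v ∧ HasWalk G l u v := by
  obtain ⟨w, rfl⟩ := h
  generalize hx : g u = x at w
  induction w generalizing u with
  | nil => exact ⟨u, hx.symm, HasWalk.zero _ _⟩
  | cons h w ih =>
    obtain ⟨-, a, b, hab, h1, h2⟩ := h
    obtain rfl := hg (h1.trans hx.symm)
    obtain ⟨v, hv, hw⟩ := ih h2
    refine ⟨v, hv, ?_⟩
    change HasWalk G (w.length + 1) a v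
    rw [add_comm]
    exact (hasWalk_one.2 hab).trans hw

theorem hasWalk_of_map {g : V → W} (hg : Function.Injective g) {l : ℕ} {u v : V}
    (h : HasWalk (G.map g) l (g u) (g v)) : HasWalk G l u v := by
  obtain ⟨w, hw, h'⟩ := h.exists_of_map hg
  rwa [hg hw]

theorem OddWalkFree.map {g : V → W} (hg : Function.Injective g) {n : ℕ} (h : OddWalkFree G n) :
    OddWalkFree (G.map g) n := by
  intro x l hl hln hw
  obtain ⟨z, -, a, b, hab, rfl, -⟩ := hw.exists_adj_left (by rintro rfl; simp at hl)
  exact h a l hl hln (hasWalk_of_map hg hw)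

theorem OddWalkFree.anti {G' : SimpleGraph V} {n : ℕ} (hle : G ≤ G') (h : OddWalkFree G' n) :
    OddWalkFree G n := fun u l hl hln hw => h u l hl hln (hw.mono hle)

/-- Walks from `x` to `y` of any color other than `c` are too long to be part of an odd cycle of
`F` together with a walk of length two or more. -/
def LongWalks (F : Set (FinColoredGraph r)) (γ : G.EdgeLabeling (Fin r)) (c : Fin r) (x y : V) :
    Prop :=
  ∀ j ≠ c, ∀ A ∈ F, A.MonoOf j → A.graph ≠ ⊤ → ∀ l, HasWalk (γ.labelGraph j) l x y →
    Nat.card A.V ≤ l + 1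

theorem LongWalks.symm {γ : G.EdgeLabeling (Fin r)} {x y : V} (h : LongWalks F γ c x y) :
    LongWalks F γ c y x := fun j hj A hA hi hT l hl => h j hj A hA hi hT l hl.symm

/-- A clique with a vertex outside the copy of `G` lies in the copy of `H`. An odd cycle of color
`j` reduces to walks of lengths `p` and `q` between the shared ends, one on each side. If `j = c`,
the shared edge closes both, so both lengths are odd. If `j ≠ c`, then `q ≥ 2`, and `LongWalks`
makes `p + q` exceed the length of the cycle. -/
theorem isFree_glue (hF : IsCycleCliqueFamily m F) {d : G.Dart} {f : H.Dart}
    {γ : G.EdgeLabeling (Fin r)} {δ : H.EdgeLabeling (Fin r)} (hγ : IsFree F G γ)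
    (hδ : IsFree F H δ) (hc : γ ⟨d.edge, d.edge_mem⟩ = c) (hc' : δ ⟨f.edge, f.edge_mem⟩ = c)
    (hl : LongWalks F γ c d.fst d.snd) : IsFree F (glue d f) (glueLabel d f γ δ) := by
  have hcc := hc.trans hc'.symm
  intro A hA hex
  rcases hF.cases hA with ⟨hT, -⟩ | ⟨hT, hodd, h3, ⟨φ⟩, j, hj⟩
  · obtain ⟨h, hh⟩ := hex
    by_cases hall : ∀ a, ∃ v, h a = Sum.inl v
    · choose g hg using hall
      let g' : A.graph →g G := ⟨g, fun {a b} hab => glueInl_adj (d := d) (f := f) (by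
        rw [← hg, ← hg]; exact h.map_adj hab)⟩
      have hcomp : h = (glueInl d f).comp g' := by ext a; exact hg a
      rw [hcomp] at hh
      refine hγ A hA ⟨g', fun e => ?_⟩
      rw [← hh e, mapEdgeSet_comp, glueLabel_inl γ δ]
    · push Not at hall
      obtain ⟨a, ha⟩ := hall
      have hr : ∀ b, ∃ w, h b = glueRight d f w := by
        intro b
        by_cases hab : a = b
        · subst hab
          cases hx : h a with
          | inl v => exact absurd hx (ha v)
          | inr z => exact ⟨z, (glueRight_of_inr z).symm⟩
        · rcases h.map_adj (show A.graph.Adj a b by rw [hT]; exact hab) with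
            ⟨u, v, -, h1, -⟩ | ⟨u, v, -, -, h2⟩
          · exact absurd h1 (ha u)
          · exact ⟨v, h2⟩
      choose g hg using hr
      let g' : A.graph →g H := ⟨g, fun {a b} hab => glueRight_adj (d := d) (f := f) (by
        rw [← hg, ← hg]; exact h.map_adj hab)⟩
      have hcomp : h = (glueInr d f).comp g' := by ext a; exact hg a
      rw [hcomp] at hh
      refine hδ A hA ⟨g', fun e => ?_⟩
      rw [← hh e, mapEdgeSet_comp, glueLabel_inr hcc]
  · rw [mono_hom_iff hj] at hex
    obtain ⟨h⟩ := hex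
    have hinl : Function.Injective (Sum.inl : V → GlueVert d f) := Sum.inl_injective
    have hγw := hγ.oddWalkFree hF hA hj hT
    have hδw := hδ.oddWalkFree hF hA hj hT
    have hfree : OddWalkFree ((γ.labelGraph j).map (Sum.inl : V → GlueVert d f) ⊔
        (δ.labelGraph j).map (glueRight d f)) (Nat.card A.V) := by
      refine oddWalkFree_sup (fun z u v hu hv => glue_common _ _ hu hv) (hγw.map hinl)
        (hδw.map (glueRight_injective d f)) fun p q hpq hp hq => ?_
      replace hp := hasWalk_of_map hinl hp
      rw [← glueRight_fst (d := d) (f := f), ← glueRight_snd (d := d) (f := f)] at hq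
      replace hq := hasWalk_of_map (glueRight_injective d f) hq
      have hp0 : p ≠ 0 := by
        rintro rfl
        exact d.adj.ne hp.eq_of_zero
      have hq0 : q ≠ 0 := by
        rintro rfl
        exact f.adj.ne hq.eq_of_zero
      by_cases hjc : j = c
      · subst hjc
        have h1 : (γ.labelGraph j).Adj d.snd d.fst :=
          ((EdgeLabeling.labelGraph_adj _ _).2 ⟨d.adj, hc⟩).symm
        have h2 : (δ.labelGraph j).Adj f.snd f.fst :=
          ((EdgeLabeling.labelGraph_adj _ _).2 ⟨f.adj, hc'⟩).symm
        have h3 : ¬ Odd (p + 1) := fun ho =>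
          hγw _ (p + 1) ho (by omega) (hp.trans (hasWalk_one.2 h1))
        have h4 : ¬ Odd (q + 1) := fun ho =>
          hδw _ (q + 1) ho (by omega) (hq.trans (hasWalk_one.2 h2))
        rw [Nat.not_odd_iff_even] at h3 h4
        rw [Nat.even_add]
        rw [Nat.even_add_one] at h3 h4
        tauto
      · exfalso
        have h1 := hl j hjc A hA hj hT p hp
        have hq1 : q ≠ 1 := by
          rintro rfl
          obtain ⟨_, h⟩ := (EdgeLabeling.labelGraph_adj _ _).1 (hasWalk_one.1 hq)
          exact hjc (h.symm.trans hc')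
        omega
    exact ((hfree.anti (labelGraph_glueLabel_le hcc j)).isEmpty_hom hodd h3).false
      (h.comp φ.symm.toHom)

/-- Extensions of `ξ` give the dart `d` exactly the colors outside `S`, one end of `d` lies on no
colored edge, and every color outside `S` is given by an extension with long walks. -/
structure IsAvoider (F : Set (FinColoredGraph r)) (S : Set (Fin r)) (G : SimpleGraph V)
    (ξ : PartialColoring G r) (d : G.Dart) : Prop where
  uncolored : ξ ⟨d.edge, d.edge_mem⟩ = none
  free_fst : ∀ e, ξ e ≠ none → d.fst ∉ (e : Sym2 V)
  notMem : ∀ γ, IsFreeExtension F G ξ γ → γ ⟨d.edge, d.edge_mem⟩ ∉ S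
  exists_extension : ∀ c ∉ S, ∃ γ, IsFreeExtension F G ξ γ ∧ γ ⟨d.edge, d.edge_mem⟩ = c ∧
    LongWalks F γ c d.fst d.snd

namespace IsAvoider

variable {S S' : Set (Fin r)} {ξ : PartialColoring G r} {d : G.Dart} {ξ' : PartialColoring H r}
  {f : H.Dart}

theorem hasFreeEndpoint (h : IsAvoider F S G ξ d) : HasFreeEndpoint ξ ⟨d.edge, d.edge_mem⟩ :=
  ⟨d.fst, Sym2.mem_mk_left _ _, h.free_fst⟩

/-- A color that occurs in some extension lies outside `S`, so it also occurs in an extension with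
long walks, and that one is glued. Long walks do not depend on the direction of the edge. -/
theorem isSafe (hF : IsCycleCliqueFamily m F) (h : IsAvoider F S G ξ d) (hc : c ∉ S) :
    IsSafe F G ξ ⟨d.edge, d.edge_mem⟩ := by
  refine ⟨h.uncolored, ?_, ?_⟩
  · obtain ⟨γ, hγ, -⟩ := h.exists_extension c hc
    exact ⟨γ, hγ⟩
  · rintro W H δ hδ d' f hd ⟨γ₀, hγ₀, hγ₀f⟩
    obtain ⟨γ, hγ, hγd, hl⟩ := h.exists_extension _ (h.notMem γ₀ hγ₀)
    have hd' : γ ⟨d'.edge, d'.edge_mem⟩ = γ ⟨d.edge, d.edge_mem⟩ :=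
      congrArg γ (Subtype.ext hd)
    have hcc := hγ₀f.trans hγd.symm
    have hl' : LongWalks F γ (γ₀ ⟨d.edge, d.edge_mem⟩) d'.fst d'.snd := by
      rcases (dart_edge_eq_iff _ _).1 hd with rfl | rfl
      · exact hl
      · exact hl.symm
    refine ⟨glueLabel d' f γ δ, isFree_glue hF hγ.2 hδ (hd'.trans hγd) hγ₀f hl', ?_, ?_⟩
    · intro e k hk
      exact (glueLabel_inl γ δ e).trans (hγ.1 e k hk)
    · exact glueLabel_inr (hd'.trans hcc.symm)

/-- Extensions of the glued graph restrict to both sides, which excludes `S` and `S'`. Conversely,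
extensions of both sides that agree on the shared edge can be glued; a walk between its ends
shortens to a walk on one side, so long walks persist. The free first ends are identified, so the
common vertex stays free. -/
theorem glue (hF : IsCycleCliqueFamily m F) (h : IsAvoider F S G ξ d)
    (h' : IsAvoider F S' H ξ' f) :
    IsAvoider F (S ∪ S') (EdgeCol.glue d f) (glueLabel d f ξ ξ')
      ((glueInl d f).mapDart d) := by
  have hξ : ξ ⟨d.edge, d.edge_mem⟩ = ξ' ⟨f.edge, f.edge_mem⟩ := h.uncolored.trans h'.uncolored.symm
  refine ⟨(glueLabel_inl ξ ξ' _).trans h.uncolored, ?_, ?_, ?_⟩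
  · intro e he hmem
    rcases exists_of_mem_glue e with ⟨e', rfl⟩ | ⟨e', rfl⟩
    · rw [glueLabel_inl] at he
      obtain ⟨a, ha, haeq⟩ := Sym2.mem_map.1 hmem
      exact h.free_fst e' he (Sum.inl_injective haeq ▸ ha)
    · rw [glueLabel_inr hξ] at he
      obtain ⟨a, ha, haeq⟩ := Sym2.mem_map.1 hmem
      have : a = f.fst := glueRight_injective d f (haeq.trans glueRight_fst.symm)
      exact h'.free_fst e' he (this ▸ ha)
  · rintro γ ⟨hγ, hγf⟩ (hmem | hmem)
    · refine h.notMem (γ.pullback (glueInl d f)) ⟨fun e c he => ?_, hγf.pullback _⟩ hmem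
      exact hγ _ c (by rw [glueLabel_inl, he])
    · refine h'.notMem (γ.pullback (glueInr d f)) ⟨fun e c he => ?_, hγf.pullback _⟩ ?_
      · exact hγ _ c (by rw [glueLabel_inr hξ, he])
      · rw [EdgeLabeling.pullback_apply, ← glueInl_mapEdgeSet_dart]
        exact hmem
  · intro c hc
    obtain ⟨γ, hγ, hγd, hl⟩ := h.exists_extension c fun hS => hc (Or.inl hS)
    obtain ⟨δ, hδ, hδf, hl'⟩ := h'.exists_extension c fun hS => hc (Or.inr hS)
    have hcc := hγd.trans hδf.symm
    refine ⟨glueLabel d f γ δ, ⟨fun e k hk => ?_, isFree_glue hF hγ.2 hδ.2 hγd hδf hl⟩,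
      (glueLabel_inl γ δ _).trans hγd, ?_⟩
    · rcases exists_of_mem_glue e with ⟨e', rfl⟩ | ⟨e', rfl⟩
      · rw [glueLabel_inl] at hk ⊢
        exact hγ.1 _ _ hk
      · rw [glueLabel_inr hξ] at hk
        rw [glueLabel_inr hcc]
        exact hδ.1 _ _ hk
    · intro j hj A hA hi hT l hw
      have hw' : HasWalk _ l (Sum.inl d.fst : GlueVert d f) (Sum.inl d.snd) :=
        hw.mono (labelGraph_glueLabel_le hcc j)
      obtain ⟨p, hp, hp' | hp'⟩ :=
        exists_hasWalk_of_sup (fun z u v hu hv => glue_common _ _ hu hv) hw'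
      · have := hl j hj A hA hi hT p (hasWalk_of_map Sum.inl_injective hp')
        omega
      · rw [← glueRight_fst (d := d) (f := f), ← glueRight_snd (d := d) (f := f)] at hp'
        have := hl' j hj A hA hi hT p (hasWalk_of_map (glueRight_injective d f) hp')
        omega

end IsAvoider

end EdgeCol

/-! ### Critical graphs and blocked edges -/

namespace EdgeCol

variable {r m : ℕ} {F : Set (FinColoredGraph r)} {A : FinColoredGraph r} {V : Type}

/-- A member of the family that maps to a graph with a pendant edge also maps to the graph without
that edge. -/
theorem nonempty_hom_of_pendant (hF : IsCycleCliqueFamily m F) (hA : A ∈ F) {K : SimpleGraph V}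
    {x y : V} (hx : ∀ v, ¬ K.Adj x v) (h : Nonempty (A.graph →g K ⊔ edge x y)) :
    Nonempty (A.graph →g K) := by
  classical
  by_cases hxy : x = y
  · subst hxy
    rwa [edge_self_eq_bot, sup_bot_eq] at h
  have hpend : ∀ v, (K ⊔ edge x y).Adj x v → v = y := by
    rintro v (h | h)
    · exact absurd h (hx v)
    · rw [edge_adj] at h
      grind
  rcases hF.cases hA with ⟨hT, h3⟩ | ⟨hT, hodd, h3, ⟨φ⟩, -⟩
  · obtain ⟨g⟩ := h
    have hadj : ∀ a b, a ≠ b → (K ⊔ edge x y).Adj (g a) (g b) := fun a b hab =>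
      g.map_adj (by rw [hT]; exact hab)
    -- A vertex of a clique on at least three vertices has two distinct neighbors, while `x` has
    -- only `y`.
    have hgx : ∀ a, g a ≠ x := by
      intro a ha
      have := A.fin
      have := Fintype.ofFinite A.V
      rw [Nat.card_eq_fintype_card] at h3
      obtain ⟨b, hb, c, hc, hbc⟩ := Finset.one_lt_card.1 (show 1 < (Finset.univ.erase a).card by
        rw [Finset.card_erase_of_mem (Finset.mem_univ a), Finset.card_univ]; omega)
      have h1 := hpend _ (ha ▸ hadj a b (Finset.ne_of_mem_erase hb).symm)
      have h2 := hpend _ (ha ▸ hadj a c (Finset.ne_of_mem_erase hc).symm)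
      exact (hadj b c hbc).ne (h1.trans h2.symm)
    refine ⟨⟨g, fun {a b} hab => ?_⟩⟩
    rcases g.map_adj hab with h | h
    · exact h
    · rw [edge_adj] at h
      rcases h.1 with h | h
      · exact absurd h.1 (hgx a)
      · exact absurd h.2 (hgx b)
  · by_contra hne
    rw [not_nonempty_iff] at hne
    have hK : OddWalkFree K (Nat.card A.V) := oddWalkFree_of_isEmpty_hom hodd (by omega)
      ⟨fun f => hne.false (f.comp φ.toHom)⟩
    have hE : OddWalkFree (edge x y) (Nat.card A.V) := by
      intro u l hl _ hw
      have := hw.even_iff (fun v => if v = x then 0 else 1) (by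
        intro u v huv
        rw [edge_adj] at huv
        rcases huv.1 with ⟨rfl, rfl⟩ | ⟨rfl, rfl⟩
        · simp [Ne.symm hxy]
        · simp [Ne.symm hxy])
      exact Nat.not_even_iff_odd.2 hl (this.2 Iff.rfl)
    -- The edge meets `K` in `y` only, so nothing has to be far apart.
    have hs : OddWalkFree (K ⊔ edge x y) (Nat.card A.V) := by
      refine oddWalkFree_sup_of_far (T := {y}) (fun z u v h1 h2 => ?_) hK hE
        fun t ht t' ht' _ _ _ => by rw [ht, ht']
      rw [edge_adj] at h2
      rcases h2.1 with h | h
      · exact absurd (h.1 ▸ h1) (hx u)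
      · exact h.1
    obtain ⟨g⟩ := h
    exact (hs.isEmpty_hom hodd h3).false (g.comp φ.symm.toHom)

/-- If a partial coloring that leaves `x` free has no `F`-free extension, then some subgraph has
one, but is blocked at a further edge `xy` in every color. -/
theorem exists_blocked_edge [Finite V] (hF : IsCycleCliqueFamily m F) {G : SimpleGraph V}
    (hG : G.CliqueFree m) (c : Sym2 V → Option (Fin r)) (x : V) (hcx : ∀ e, x ∈ e → c e = none)
    (hno : ∀ γ, ¬ IsFreeExtension F G (fun e => c e) γ)
    (hx : ∀ G' ≤ G, (∀ v, ¬ G'.Adj x v) → ∃ γ, IsFreeExtension F G' (fun e => c e) γ) :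
    ∃ D ≤ G, ∃ y, G.Adj x y ∧ ¬ D.Adj x y ∧ (∃ γ, IsFreeExtension F D (fun e => c e) γ) ∧
      ∀ γ, IsFreeExtension F D (fun e => c e) γ → ∀ i, ∃ A ∈ F, A.MonoOf i ∧
        Nonempty (A.graph →g γ.labelGraph i ⊔ edge x y) := by
  classical
  obtain ⟨G', hG', hmin⟩ := exists_minimal_le_of_wellFoundedLT
    (fun G' : SimpleGraph V => ∀ γ, ¬ IsFreeExtension F G' (fun e => c e) γ) G hno
  obtain ⟨y, hxy⟩ : ∃ y, G'.Adj x y := by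
    by_contra h
    push Not at h
    obtain ⟨γ, hγ⟩ := hx G' hG' h
    exact hmin.prop γ hγ
  have hDle : G'.deleteEdges {s(x, y)} ≤ G' := deleteEdges_le _
  have hDne : ¬ (G'.deleteEdges {s(x, y)}).Adj x y := by simp
  refine ⟨G'.deleteEdges {s(x, y)}, hDle.trans hG', y, hG' hxy, hDne, ?_, fun γ hγ i => ?_⟩
  · by_contra h
    push Not at h
    exact hDne (hmin.le_of_le h hDle hxy)
  · let γ' : G'.EdgeLabeling (Fin r) := fun e =>
      if h : (e : Sym2 V) ∈ (G'.deleteEdges {s(x, y)}).edgeSet then γ ⟨e, h⟩ else i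
    have hdel : ∀ u v, G'.Adj u v → ¬ (G'.deleteEdges {s(x, y)}).Adj u v → s(u, v) = s(x, y) := by
      intro u v huv h
      rw [deleteEdges_adj] at h
      by_contra hne
      exact h ⟨huv, hne⟩
    have hlab : ∀ j, ∀ u v, (γ'.labelGraph j).Adj u v → (γ.labelGraph j).Adj u v ∨
        (j = i ∧ s(u, v) = s(x, y)) := by
      intro j u v h
      obtain ⟨h1, h2⟩ := (EdgeLabeling.labelGraph_adj _ _).1 h
      by_cases h3 : (G'.deleteEdges {s(x, y)}).Adj u v
      · refine Or.inl ((EdgeLabeling.labelGraph_adj _ _).2 ⟨h3, ?_⟩)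
        rwa [show γ' ⟨s(u, v), h1⟩ = γ ⟨s(u, v), h3⟩ from dif_pos h3] at h2
      · rw [show γ' ⟨s(u, v), h1⟩ = i from dif_neg h3] at h2
        exact Or.inr ⟨h2.symm, hdel u v h1 h3⟩
    have hext : Extends γ' (fun e : G'.edgeSet => c e) := by
      rintro ⟨e, he⟩ k hk
      by_cases h3 : e ∈ (G'.deleteEdges {s(x, y)}).edgeSet
      · exact (dif_pos h3).trans (hγ.1 ⟨e, h3⟩ k hk)
      · induction e using Sym2.ind with | _ u v
        have := hdel u v he h3
        have hn : c s(u, v) = none := hcx _ (by rw [this]; exact Sym2.mem_mk_left _ _)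
        exact absurd (hn.symm.trans hk) (by simp)
    by_contra hcon
    push Not at hcon
    refine hmin.prop γ' ⟨hext, isFree_of_cliqueFree hF (hG.anti hG') fun A hA j hj => ⟨fun g => ?_⟩⟩
    by_cases hji : j = i
    · subst hji
      refine (hcon A hA hj).false ((Hom.ofLE fun u v huv => ?_).comp g)
      rcases hlab _ u v huv with h | ⟨-, h⟩
      · exact Or.inl h
      · right
        rw [edge_adj]
        exact ⟨by rcases Sym2.eq_iff.1 h with ⟨rfl, rfl⟩ | ⟨rfl, rfl⟩ <;> simp, huv.ne⟩
    · refine (hγ.2.isEmpty_hom hA hj).false ((Hom.ofLE fun u v huv => ?_).comp g)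
      rcases hlab _ u v huv with h | ⟨h, -⟩
      · exact h
      · exact absurd h hji

/-- There is a `K_m`-free graph without an `F`-free coloring that has one after the deletion of all
edges at a vertex. -/
theorem exists_critical [NeZero r] (hm : 3 ≤ m) (hF : IsCycleCliqueFamily m F)
    (hmono : ∀ i : Fin r, ∃ A ∈ F, A.MonoOf i ∧ A.graph.CliqueFree m) :
    ∃ (V : Type) (_ : Finite V) (G : SimpleGraph V) (x : V), G.CliqueFree m ∧
      (∀ γ, ¬ IsFree F G γ) ∧ ∀ G' ≤ G, (∀ v, ¬ G'.Adj x v) → ∃ γ, IsFree F G' γ := by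
  choose B hBF hBm hBc using hmono
  have hfin : ∀ i, Finite (B i).V := fun i => (B i).fin
  -- A copy of the disjoint union that is monochromatic in color `k` contains the member `B k` in
  -- its own color.
  let U : SimpleGraph (Σ i, (B i).V) :=
    { Adj := fun p q => ∃ i u v, (B i).graph.Adj u v ∧ p = ⟨i, u⟩ ∧ q = ⟨i, v⟩
      symm := ⟨fun _ _ ⟨i, u, v, h, hp, hq⟩ => ⟨i, v, u, h.symm, hq, hp⟩⟩
      loopless := ⟨by
        rintro _ ⟨i, u, v, h, rfl, hq⟩
        exact h.ne (by simpa using hq)⟩ }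
  have hU : U.CliqueFree m := by
    rw [cliqueFree_iff_isEmpty_hom]
    refine ⟨fun t => ?_⟩
    have key : ∃ i, ∀ k, ∃ u : (B i).V, t k = ⟨i, u⟩ := by
      refine ⟨(t ⟨0, by omega⟩).1, fun k => ?_⟩
      by_cases hk : (⟨0, by omega⟩ : Fin m) = k
      · rw [← hk]; exact ⟨_, rfl⟩
      · obtain ⟨i, u, v, -, h1, h2⟩ := t.map_adj
          (show (⊤ : SimpleGraph (Fin m)).Adj ⟨0, by omega⟩ k from hk)
        rw [h1, h2]
        exact ⟨v, rfl⟩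
    obtain ⟨i, hi⟩ := key
    choose g hg using hi
    refine (cliqueFree_iff_isEmpty_hom.1 (hBc i)).false ⟨g, fun {a b} hab => ?_⟩
    obtain ⟨j, u, v, huv, h1, h2⟩ := t.map_adj hab
    rw [hg] at h1 h2
    obtain rfl : i = j := congrArg Sigma.fst h1
    obtain rfl : g a = u := by simpa using h1
    obtain rfl : g b = v := by simpa using h2
    exact huv
  obtain ⟨V, hV, G, hG, hc⟩ := exists_cliqueFree_arrow (r := r) hm U hU
  have hno : ∀ γ, ¬ IsFree F G γ := by
    classical
    intro γ hγ
    obtain ⟨h, k, hk⟩ := hc fun e => if he : e ∈ G.edgeSet then γ ⟨e, he⟩ else 0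
    refine (hγ.isEmpty_hom (hBF k) (hBm k)).false ⟨fun u => h ⟨k, u⟩, fun {u v} huv => ?_⟩
    have hUadj : U.Adj ⟨k, u⟩ ⟨k, v⟩ := ⟨k, u, v, huv, rfl, rfl⟩
    refine (EdgeLabeling.labelGraph_adj _ _).2 ⟨h.map_adj hUadj, ?_⟩
    exact (dif_pos (h.map_adj hUadj)).symm.trans (hk _ _ hUadj)
  obtain ⟨G', hG', hmin⟩ := exists_minimal_le_of_wellFoundedLT
    (fun G' : SimpleGraph V => ∀ γ, ¬ IsFree F G' γ) G hno
  obtain ⟨x, y, hxy⟩ : ∃ x y, G'.Adj x y := by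
    by_contra h
    push Not at h
    obtain rfl : G' = ⊥ := by
      ext a b
      simpa using h a b
    exact hmin.prop (fun _ => 0) (isFree_bot hF _)
  refine ⟨V, hV, G', x, hG.anti hG', hmin.prop, fun G'' hG'' hx => ?_⟩
  by_contra h
  push Not at h
  exact hx y (hmin.le_of_le h hG'' hxy)

theorem isFreeExtension_none {G : SimpleGraph V} {γ : G.EdgeLabeling (Fin r)} :
    IsFreeExtension F G (fun _ => none) γ ↔ IsFree F G γ :=
  ⟨fun h => h.2, fun h => ⟨fun _ _ he => absurd he (by simp), h⟩⟩

/-- There is a graph with a vertex at which all colors occur in every `F`-free coloring. -/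
theorem exists_vertex_all_colors [NeZero r] (hm : 3 ≤ m) (hF : IsCycleCliqueFamily m F)
    (hmono : ∀ i : Fin r, ∃ A ∈ F, A.MonoOf i ∧ A.graph.CliqueFree m) :
    ∃ (V : Type) (_ : Finite V) (H : SimpleGraph V) (x : V), (∃ γ, IsFree F H γ) ∧
      ∀ γ, IsFree F H γ → ∀ i : Fin r, ∃ e : H.edgeSet, x ∈ (e : Sym2 V) ∧ γ e = i := by
  obtain ⟨V, hV, G, x, hG, hno, hx⟩ := exists_critical hm hF hmono
  obtain ⟨D, -, y, -, -, hex, hbl⟩ := exists_blocked_edge hF hG (fun _ => none) x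
    (fun _ _ => rfl) (fun γ hγ => hno γ hγ.2) (fun G' h1 h2 => by
      obtain ⟨γ, hγ⟩ := hx G' h1 h2
      exact ⟨γ, isFreeExtension_none.2 hγ⟩)
  simp only [isFreeExtension_none] at hex hbl
  refine ⟨V, hV, D, x, hex, fun γ hγ i => ?_⟩
  by_contra hcon
  push Not at hcon
  -- If color `i` is missing at `x`, the blocked edge is pendant in its class.
  obtain ⟨A, hA, hi, hh⟩ := hbl γ hγ i
  refine not_nonempty_iff.2 (hγ.isEmpty_hom hA hi) (nonempty_hom_of_pendant hF hA ?_ hh)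
  intro v hv
  obtain ⟨h1, h2⟩ := (EdgeLabeling.labelGraph_adj _ _).1 hv
  exact hcon ⟨s(x, v), h1⟩ (Sym2.mem_mk_left _ _) h2

/-- There is a colored graph that is blocked at a further edge `xy` in every color, and remains so
if the edges at `x` are recolored. -/
theorem exists_blocked [NeZero r] (hm : 3 ≤ m) (hF : IsCycleCliqueFamily m F)
    (hmono : ∀ i : Fin r, ∃ A ∈ F, A.MonoOf i ∧ A.graph.CliqueFree m) :
    ∃ (V : Type) (_ : Finite V) (D : SimpleGraph V) (x y : V) (γ₀ : D.EdgeLabeling (Fin r)),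
      x ≠ y ∧ ¬ D.Adj x y ∧ (D ⊔ edge x y).CliqueFree m ∧ IsFree F D γ₀ ∧
      ∀ γ, IsFree F D γ → (∀ e : D.edgeSet, x ∉ (e : Sym2 V) → γ e = γ₀ e) → ∀ i, ∃ A ∈ F, A.MonoOf i ∧
        Nonempty (A.graph →g γ.labelGraph i ⊔ edge x y) := by
  classical
  obtain ⟨V, hV, G, x, hG, hno, hx⟩ := exists_critical hm hF hmono
  let G₀ := G.deleteEdges {e | x ∈ e}
  obtain ⟨δ, hδ⟩ := hx G₀ (deleteEdges_le _) (fun v h => by simp [G₀] at h)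
  -- Prescribing `δ` on all edges away from `x` makes the blockage hold for every free recoloring at
  -- `x`. Subgraphs without an edge at `x` lie in `G₀` and inherit `δ`.
  obtain ⟨D, hDG, y, hxy, hDxy, ⟨γ₀, hγ₀⟩, hbl⟩ := exists_blocked_edge hF hG
    (fun e => if h : e ∈ G₀.edgeSet then some (δ ⟨e, h⟩) else none) x
    (fun e he => dif_neg (by simp [G₀, he])) (fun γ hγ => hno γ hγ.2) (fun G' h1 h2 => by
      have hle : G' ≤ G₀ := fun u v huv => by
        rw [deleteEdges_adj]
        refine ⟨h1 huv, fun hmem => ?_⟩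
        rcases Sym2.mem_iff.1 hmem with rfl | rfl
        · exact h2 _ huv
        · exact h2 _ huv.symm
      refine ⟨δ.pullback (Hom.ofLE hle), fun e k hk => ?_, hδ.pullback _⟩
      have he : (e : Sym2 V) ∈ G₀.edgeSet := edgeSet_mono hle e.2
      replace hk := (dif_pos he).symm.trans hk
      rw [EdgeLabeling.pullback_apply, ← Option.some_injective _ hk]
      congr 1
      exact Subtype.ext (by simp [Hom.mapEdgeSet]))
  refine ⟨V, hV, D, x, y, γ₀, hxy.ne, hDxy, hG.anti (sup_le hDG ?_), hγ₀.2, fun γ hγ h => ?_⟩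
  · rw [edge_le_iff]
    exact Or.inr hxy
  · refine hbl γ ⟨fun e k hk => ?_, hγ⟩
    by_cases he : x ∈ (e : Sym2 V)
    · have he' : (e : Sym2 V) ∉ G₀.edgeSet := by simp [G₀, he]
      exact absurd ((dif_neg he').symm.trans hk) (by simp)
    · rw [h e he]
      exact hγ₀.1 e k hk

end EdgeCol

namespace EdgeCol

variable {r m : ℕ} {F : Set (FinColoredGraph r)} {V V' : Type} {D : SimpleGraph V}

/-! ### Confining the blockage to one color -/

section Attach

variable {ι : V ↪ V'} {B : SimpleGraph V'} {x : V} {y' : V'} {K : Type*}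

/-- The graph `D` with further edges `B` and a further edge from a vertex `x` of `D` to `y'`. -/
abbrev attach (D : SimpleGraph V) (ι : V ↪ V') (B : SimpleGraph V') (x : V) (y' : V') :
    SimpleGraph V' :=
  D.map ι ⊔ B ⊔ edge (ι x) y'

/-- The inclusion of `D`. -/
def attachHom (D : SimpleGraph V) (ι : V ↪ V') (B : SimpleGraph V') (x : V) (y' : V') :
    D →g attach D ι B x y' where
  toFun := ι
  map_rel' h := Or.inl (Or.inl (map_adj_apply.2 h))

open Classical in
/-- The labeling of the edges of `attach D ι B x y'` by `γ` on `D`, by `b` on `B` and by `k` on the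
last edge. -/
noncomputable def attachLabel (ι : V ↪ V') (B : SimpleGraph V') (x : V) (y' : V')
    (γ : D.EdgeLabeling K) (b k : K) : (attach D ι B x y').EdgeLabeling K := fun e =>
  if h : ∃ e', (attachHom D ι B x y').mapEdgeSet e' = e then γ h.choose
  else if (e : Sym2 V') ∈ B.edgeSet then b else k

theorem attachLabel_hom (γ : D.EdgeLabeling K) (b k : K) (e : D.edgeSet) :
    attachLabel ι B x y' γ b k ((attachHom D ι B x y').mapEdgeSet e) = γ e := by
  have h : ∃ e', (attachHom D ι B x y').mapEdgeSet e' = (attachHom D ι B x y').mapEdgeSet e :=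
    ⟨e, rfl⟩
  rw [attachLabel, dif_pos h, Hom.mapEdgeSet.injective _ ι.injective h.choose_spec]

theorem attachLabel_new (hB : ∀ u v, ¬ B.Adj (ι u) (ι v)) (γ : D.EdgeLabeling K) (b k : K)
    {u v : V'} (h : (attach D ι B x y').Adj u v) (huv : B.Adj u v) :
    attachLabel ι B x y' γ b k ⟨s(u, v), h⟩ = b := by
  have hne : ¬ ∃ e', (attachHom D ι B x y').mapEdgeSet e' = ⟨s(u, v), h⟩ := by
    rintro ⟨⟨e, he⟩, h'⟩
    induction e using Sym2.ind with | _ a c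
    have h'' : s(ι a, ι c) = s(u, v) := congrArg Subtype.val h'
    rcases Sym2.eq_iff.1 h'' with ⟨rfl, rfl⟩ | ⟨rfl, rfl⟩
    · exact hB _ _ huv
    · exact hB _ _ huv
  rw [attachLabel, dif_neg hne]
  exact if_pos huv

theorem attachLabel_last (hBx : ∀ v, ¬ B.Adj (ι x) v) (hy : ∀ v, ι v ≠ y') (γ : D.EdgeLabeling K)
    (b k : K) {u v : V'} (h : (attach D ι B x y').Adj u v) (huv : s(u, v) = s(ι x, y')) :
    attachLabel ι B x y' γ b k ⟨s(u, v), h⟩ = k := by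
  have hne : ¬ ∃ e', (attachHom D ι B x y').mapEdgeSet e' = ⟨s(u, v), h⟩ := by
    rintro ⟨⟨e, he⟩, h'⟩
    induction e using Sym2.ind with | _ a c
    have h'' : s(ι a, ι c) = s(u, v) := congrArg Subtype.val h'
    rcases Sym2.eq_iff.1 (h''.trans huv) with ⟨-, h⟩ | ⟨h, -⟩
    · exact hy _ h
    · exact hy _ h
  rw [attachLabel, dif_neg hne]
  exact if_neg fun hmem => hBx y' (show s(ι x, y') ∈ B.edgeSet from huv ▸ hmem)

theorem attach_edge_cases {u v : V'} (h : (attach D ι B x y').Adj u v) :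
    (∃ e', (attachHom D ι B x y').mapEdgeSet e' = ⟨s(u, v), h⟩) ∨ B.Adj u v ∨
      s(u, v) = s(ι x, y') := by
  rcases h with (h | h) | h
  · obtain ⟨a, b, hab, rfl, rfl⟩ := (map_adj _ _ _ _).1 h
    exact Or.inl ⟨⟨s(a, b), hab⟩, rfl⟩
  · exact Or.inr (Or.inl h)
  · exact Or.inr (Or.inr ((adj_edge ..).1 h).1.symm)

/-- Forget everything outside `D`. -/
theorem nonempty_hom_of_map (x : V) (K : SimpleGraph V) : Nonempty (K.map ι →g K) := by
  have : Nonempty V := ⟨x⟩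
  refine ⟨⟨Function.invFun ι, fun {u v} huv => ?_⟩⟩
  obtain ⟨a, b, hab, rfl, rfl⟩ := (map_adj _ _ _ _).1 huv
  rwa [Function.leftInverse_invFun ι.injective, Function.leftInverse_invFun ι.injective]

theorem labelGraph_attachLabel_le [DecidableEq K] (hB : ∀ u v, ¬ B.Adj (ι u) (ι v))
    (hBx : ∀ v, ¬ B.Adj (ι x) v) (hy : ∀ v, ι v ≠ y') (γ : D.EdgeLabeling K) (b k j : K) :
    (attachLabel ι B x y' γ b k).labelGraph j ≤ (γ.labelGraph j).map ι ⊔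
      (if b = j then B else ⊥) ⊔ (if k = j then edge (ι x) y' else ⊥) := by
  intro u v huv
  obtain ⟨h, hj⟩ := (EdgeLabeling.labelGraph_adj _ _).1 huv
  rcases id h with (h' | h') | h'
  · left; left
    obtain ⟨a, c, hac, rfl, rfl⟩ := (map_adj _ _ _ _).1 h'
    refine (map_adj _ _ _ _).2 ⟨a, c, (EdgeLabeling.labelGraph_adj _ _).2 ⟨hac, ?_⟩, rfl, rfl⟩
    exact (attachLabel_hom γ b k ⟨s(a, c), hac⟩).symm.trans hj
  · left; right
    rw [attachLabel_new hB γ b k h h'] at hj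
    rwa [if_pos hj]
  · right
    have h'' : s(ι x, y') = s(u, v) := ((adj_edge ..).1 h').1
    have hj' : k = j := by
      rw [← hj, attachLabel_last hBx hy γ b k h h''.symm]
    rwa [if_pos hj']

open Classical in
/-- Forget the colors of the edges at `x`. -/
noncomputable def uncolorAt (γ : D.EdgeLabeling K) (x : V) : D.EdgeLabeling (Option K) := fun e =>
  if x ∈ (e : Sym2 V) then none else some (γ e)

theorem uncolorAt_of_mem {γ : D.EdgeLabeling K} {e : D.edgeSet} (h : x ∈ (e : Sym2 V)) :
    uncolorAt γ x e = none := if_pos h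

theorem uncolorAt_of_notMem {γ : D.EdgeLabeling K} {e : D.edgeSet} (h : x ∉ (e : Sym2 V)) :
    uncolorAt γ x e = some (γ e) := if_neg h

open Classical in
/-- A way to attach edges of color `i` so that the last edge must not have color `i`. -/
theorem isAvoider_attach (hF : IsCycleCliqueFamily m F) {i : Fin r} {γ₀ : D.EdgeLabeling (Fin r)}
    (hγ₀ : IsFree F D γ₀) (hB : ∀ u v, ¬ B.Adj (ι u) (ι v)) (hBx : ∀ v, ¬ B.Adj (ι x) v)
    (hy : ∀ v, ι v ≠ y') (hm : (attach D ι B x y').CliqueFree m)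
    (hforce : ∀ γ : D.EdgeLabeling (Fin r), IsFree F D γ →
      (∀ e : D.edgeSet, x ∉ (e : Sym2 V) → γ e = γ₀ e) → ∃ A ∈ F, A.MonoOf i ∧
        Nonempty (A.graph →g (γ.labelGraph i).map ι ⊔ B ⊔ edge (ι x) y'))
    (hfree : ∀ A ∈ F, A.MonoOf i → IsEmpty (A.graph →g (γ₀.labelGraph i).map ι ⊔ B))
    (hlong : ∀ A ∈ F, A.MonoOf i → A.graph ≠ ⊤ → ∀ l,
      HasWalk ((γ₀.labelGraph i).map ι ⊔ B) l (ι x) y' → Nat.card A.V ≤ l + 1) :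
    IsAvoider F {i} (attach D ι B x y')
      (attachLabel ι B x y' (uncolorAt γ₀ x) (some i) none)
      ⟨(ι x, y'), Or.inr ((adj_edge ..).2 ⟨rfl, hy x⟩)⟩ := by
  refine ⟨attachLabel_last hBx hy _ _ _ _ rfl, ?_, ?_, ?_⟩
  · rintro ⟨e, he⟩ hne hmem
    induction e using Sym2.ind with | _ u v
    rcases attach_edge_cases (u := u) (v := v) he with ⟨e', h⟩ | h | h
    · rw [← h, attachLabel_hom] at hne
      have hmem' : ι x ∈ Sym2.map ι e' := by
        have : Sym2.map ι e' = s(u, v) := congrArg Subtype.val h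
        rw [this]; exact hmem
      obtain ⟨a, ha, hax⟩ := Sym2.mem_map.1 hmem'
      rw [ι.injective hax] at ha
      exact hne (uncolorAt_of_mem ha)
    · rcases Sym2.mem_iff.1 hmem with h' | h'
      · exact hBx v ((congrArg (B.Adj · v) h').mpr h)
      · exact hBx u ((congrArg (B.Adj · u) h').mpr h.symm)
    · exact hne (attachLabel_last hBx hy _ _ _ _ h)
  · rintro γ ⟨hγ, hγf⟩ hi
    obtain ⟨A, hA, hAi, ⟨g⟩⟩ := hforce (γ.pullback (attachHom D ι B x y')) (hγf.pullback _)
      (fun e he => hγ _ _ (by rw [attachLabel_hom, uncolorAt_of_notMem he]))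
    refine (hγf.isEmpty_hom hA hAi).false ((Hom.ofLE fun u v huv => ?_).comp g)
    rcases huv with (h | h) | h
    · obtain ⟨a, b, hab, rfl, rfl⟩ := (map_adj _ _ _ _).1 h
      obtain ⟨hab', hab''⟩ := (EdgeLabeling.labelGraph_adj _ _).1 hab
      exact (EdgeLabeling.labelGraph_adj _ _).2 ⟨(attachHom D ι B x y').map_adj hab', hab''⟩
    · refine (EdgeLabeling.labelGraph_adj _ _).2 ⟨Or.inl (Or.inr h), hγ _ _ ?_⟩
      exact attachLabel_new hB _ _ _ _ h
    · refine (EdgeLabeling.labelGraph_adj _ _).2 ⟨Or.inr h, Eq.trans ?_ hi⟩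
      exact congrArg _ (Subtype.ext ((adj_edge ..).1 h).1.symm)
  · intro c hc
    have hci : i ≠ c := fun h => hc h.symm
    have hle := labelGraph_attachLabel_le hB hBx hy γ₀ i c
    refine ⟨attachLabel ι B x y' γ₀ i c, ⟨?_, ?_⟩, attachLabel_last hBx hy _ _ _ _ rfl, ?_⟩
    · rintro ⟨e, he⟩ k hk
      induction e using Sym2.ind with | _ u v
      rcases attach_edge_cases (u := u) (v := v) he with ⟨e', h⟩ | h | h
      · rw [← h, attachLabel_hom] at hk ⊢
        by_cases hx : x ∈ (e' : Sym2 V)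
        · rw [uncolorAt_of_mem hx] at hk
          exact absurd hk (by simp)
        · rw [uncolorAt_of_notMem hx] at hk
          exact Option.some_injective _ hk
      · rw [attachLabel_new (u := u) (v := v) hB _ _ _ he h] at hk ⊢
        exact Option.some_injective _ hk
      · exact absurd (hk.symm.trans (attachLabel_last hBx hy _ _ _ _ h)) (by simp)
    · refine isFree_of_cliqueFree hF hm fun A hA j hj => ⟨fun g => ?_⟩
      replace g := (Hom.ofLE (hle j)).comp g
      by_cases hij : i = j
      · subst hij
        rw [if_pos rfl, if_neg hci.symm, sup_bot_eq] at g
        exact (hfree A hA hj).false g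
      · rw [if_neg hij, sup_bot_eq] at g
        -- The attached edges have color `i ≠ j`, so in color `j` the last edge, if present, is
        -- pendant at `y'`, and what remains is a copy of a class of `γ₀`.
        obtain ⟨ρ⟩ := nonempty_hom_of_map (ι := ι) x (γ₀.labelGraph j)
        have hg : Nonempty (A.graph →g (γ₀.labelGraph j).map ι) := by
          split_ifs at g with hcj
          · rw [edge_comm] at g
            refine nonempty_hom_of_pendant hF hA (fun v hv => ?_) ⟨g⟩
            obtain ⟨a, b, hab, h1, -⟩ := (map_adj _ _ _ _).1 hv
            exact hy a h1
          · rw [sup_bot_eq] at g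
            exact ⟨g⟩
        obtain ⟨g'⟩ := hg
        exact (hγ₀.isEmpty_hom hA hj).false (ρ.comp g')
    · intro j hj A hA hAj hT l hw
      replace hw := hw.mono (hle j)
      rw [if_neg (Ne.symm hj), sup_bot_eq] at hw
      by_cases hij : i = j
      · subst hij
        rw [if_pos rfl] at hw
        exact hlong A hA hAj hT l hw
      · rw [if_neg hij, sup_bot_eq] at hw
        -- A class other than those of `i` and `c` stays inside the copy of `D` and never reaches
        -- `y'`.
        obtain ⟨v, hv, -⟩ := hw.exists_of_map ι.injective
        exact absurd hv.symm (hy v)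

end Attach

/-! ### Cliques: a twin of the blocked end -/

section Twin

/-- The edges from a new vertex to the neighbors of `y` in `K`. -/
def twinGraph (K : SimpleGraph V) (y : V) : SimpleGraph (Option V) where
  Adj a b := ∃ z, K.Adj y z ∧ ((a = none ∧ b = some z) ∨ (a = some z ∧ b = none))
  symm := ⟨fun _ _ ⟨z, hz, h⟩ => ⟨z, hz, by tauto⟩⟩
  loopless := ⟨by
    rintro a ⟨z, hz, ⟨rfl, h⟩ | ⟨rfl, h⟩⟩ <;> simp at h⟩

/-- If the members of `F` of color `i` are cliques, a twin of `y` with respect to color `i` gives an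
edge that must not have color `i`. -/
theorem exists_isAvoider_of_clique [Finite V] (hF : IsCycleCliqueFamily m F) {i : Fin r} {x y : V}
    {γ₀ : D.EdgeLabeling (Fin r)} (hxy : x ≠ y) (hD : ¬ D.Adj x y)
    (hm : (D ⊔ edge x y).CliqueFree m) (hγ₀ : IsFree F D γ₀)
    (hbl : ∀ γ, IsFree F D γ → (∀ e : D.edgeSet, x ∉ (e : Sym2 V) → γ e = γ₀ e) → ∃ A ∈ F,
      A.MonoOf i ∧ Nonempty (A.graph →g γ.labelGraph i ⊔ edge x y))
    (hi : ∀ A ∈ F, A.MonoOf i → A.graph = ⊤) :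
    ∃ (V' : Type) (_ : Finite V') (G : SimpleGraph V') (ξ : PartialColoring G r) (d : G.Dart),
      IsAvoider F {i} G ξ d := by
  classical
  let B := twinGraph (γ₀.labelGraph i) y
  have hB : ∀ u v, ¬ B.Adj (some u) (some v) := by
    rintro u v ⟨z, -, ⟨h, -⟩ | ⟨-, h⟩⟩ <;> simp at h
  have hBx : ∀ v, ¬ B.Adj (some x) v := by
    rintro v ⟨z, hz, ⟨h, -⟩ | ⟨h, -⟩⟩
    · simp at h
    · obtain rfl := Option.some_injective _ h
      exact hD (γ₀.labelGraph_le hz.symm)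
  refine ⟨Option V, inferInstance, _, _, _, isAvoider_attach (ι := Function.Embedding.some)
    (B := B) (x := x) (y' := none) hF hγ₀ hB hBx (by simp) ?_ ?_ ?_ ?_⟩
  -- Folding the twin back onto `y` turns the last edge into `xy`.
  · refine CliqueFree.of_hom ⟨fun a => a.getD y, fun {a b} hab => ?_⟩ hm
    rcases hab with (h | ⟨z, hz, ⟨rfl, rfl⟩ | ⟨rfl, rfl⟩⟩) | h
    · obtain ⟨a, b, hab, rfl, rfl⟩ := (map_adj _ _ _ _).1 h
      exact Or.inl hab
    · exact Or.inl (γ₀.labelGraph_le hz)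
    · exact Or.inl (γ₀.labelGraph_le hz.symm)
    · rw [edge_adj] at h
      rcases h.1 with ⟨rfl, rfl⟩ | ⟨rfl, rfl⟩
      · exact Or.inr ((edge_adj ..).2 ⟨Or.inl ⟨rfl, rfl⟩, hxy⟩)
      · exact Or.inr ((edge_adj ..).2 ⟨Or.inr ⟨rfl, rfl⟩, hxy.symm⟩)
  · intro γ hγ hγγ
    obtain ⟨A, hA, hAi, ⟨g⟩⟩ := hbl γ hγ hγγ
    refine ⟨A, hA, hAi, ⟨Hom.comp ⟨fun a => if a = y then none else some a,
      fun {a b} hab => ?_⟩ g⟩⟩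
    -- Edges at `y` avoid `x`, because `xy` is not an edge of `D`; so `γ` cannot recolor them.
    have key : ∀ z, (γ.labelGraph i).Adj y z → (γ₀.labelGraph i).Adj y z := by
      intro z hz
      obtain ⟨h1, h2⟩ := (EdgeLabeling.labelGraph_adj _ _).1 hz
      refine (EdgeLabeling.labelGraph_adj _ _).2 ⟨h1, ?_⟩
      rw [← hγγ ⟨s(y, z), h1⟩ ?_]
      · exact h2
      · intro hmem
        rcases Sym2.mem_iff.1 hmem with h | rfl
        · exact hxy h
        · exact hD h1.symm
    rcases hab with h | h
    · left
      by_cases ha : a = y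
      · subst ha
        have hb : b ≠ a := h.ne'
        right
        exact ⟨b, key b h, Or.inl (by simp [hb])⟩
      · by_cases hb : b = y
        · subst hb
          right
          exact ⟨a, key a h.symm, Or.inr (by simp [ha])⟩
        · left
          simp only [ha, hb, if_false]
          exact (map_adj _ _ _ _).2 ⟨a, b, h, rfl, rfl⟩
    · right
      rw [edge_adj] at h
      rcases h.1 with ⟨rfl, rfl⟩ | ⟨rfl, rfl⟩ <;> simp [edge_adj, hxy]
  · intro A hA hAi
    refine ⟨fun g => (hγ₀.isEmpty_hom hA hAi).false
      (Hom.comp ⟨fun a => a.getD y, fun {a b} hab => ?_⟩ g)⟩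
    rcases hab with h | ⟨z, hz, ⟨rfl, rfl⟩ | ⟨rfl, rfl⟩⟩
    · obtain ⟨a, b, hab, rfl, rfl⟩ := (map_adj _ _ _ _).1 h
      exact hab
    · exact hz
    · exact hz.symm
  · intro A hA hAi hT
    exact absurd (hi A hA hAi) hT

end Twin

end EdgeCol

namespace EdgeCol

variable {r m : ℕ} {F : Set (FinColoredGraph r)} {V : Type} {D : SimpleGraph V}

/-! ### Odd cycles: long legs to a common end -/

section Spider

variable {M : ℕ} {x : V}

/-- The vertices of `V`, the inner vertices of a leg of length `M` at every vertex, and the common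
end of all legs. -/
abbrev SpiderVert (V : Type) (M : ℕ) : Type := V ⊕ Option (V × Fin M)

/-- The vertex at distance `p` from `v` on the leg at `v`. -/
def legVert (M : ℕ) (v : V) (p : ℕ) : SpiderVert V M :=
  if p = 0 then Sum.inl v else if h : p < M then Sum.inr (some (v, ⟨p, h⟩)) else Sum.inr none

/-- The distance from `V`. -/
def spiderDepth : SpiderVert V M → ℕ
  | Sum.inl _ => 0
  | Sum.inr (some q) => q.2
  | Sum.inr none => M

theorem legVert_zero (v : V) : legVert M v 0 = Sum.inl v := rfl

theorem legVert_top (hM : 0 < M) (v : V) : legVert M v M = Sum.inr none := by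
  simp [legVert, hM.ne']

theorem spiderDepth_legVert {p : ℕ} (hp : p ≤ M) (v : V) : spiderDepth (legVert M v p) = p := by
  unfold legVert
  split_ifs with h1 h2
  · exact h1.symm
  · rfl
  · simp only [spiderDepth]; omega

theorem legVert_inj {v w : V} {p q : ℕ} (hp : p < M) (hq : q ≤ M)
    (h : legVert M v p = legVert M w q) : v = w ∧ p = q := by
  have hpq : p = q := by
    rw [← spiderDepth_legVert hp.le v, ← spiderDepth_legVert hq w, h]
  subst hpq
  refine ⟨?_, rfl⟩
  unfold legVert at h
  split_ifs at h with h1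
  · exact Sum.inl_injective h
  · simpa using h

/-- The legs at the vertices other than `x`. -/
def spider (V : Type) (M : ℕ) (x : V) : SimpleGraph (SpiderVert V M) where
  Adj a b := ∃ v p, v ≠ x ∧ p < M ∧
    ((a = legVert M v p ∧ b = legVert M v (p + 1)) ∨ (a = legVert M v (p + 1) ∧ b = legVert M v p))
  symm := ⟨fun _ _ ⟨v, p, hv, hp, h⟩ => ⟨v, p, hv, hp, by tauto⟩⟩
  loopless := ⟨by
    rintro a ⟨v, p, -, hp, ⟨h1, h2⟩ | ⟨h1, h2⟩⟩ <;>
    · have h := congrArg spiderDepth (h1.symm.trans h2)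
      rw [spiderDepth_legVert hp.le, spiderDepth_legVert hp] at h
      omega⟩

theorem spiderDepth_of_adj {a b : SpiderVert V M} (h : (spider V M x).Adj a b) :
    spiderDepth a = spiderDepth b + 1 ∨ spiderDepth b = spiderDepth a + 1 := by
  obtain ⟨v, p, -, hp, ⟨rfl, rfl⟩ | ⟨rfl, rfl⟩⟩ := h
  · right; rw [spiderDepth_legVert hp.le, spiderDepth_legVert hp]
  · left; rw [spiderDepth_legVert hp.le, spiderDepth_legVert hp]

theorem spider_not_adj_inl_inl (u v : V) : ¬ (spider V M x).Adj (Sum.inl u) (Sum.inl v) :=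
  fun h => by rcases spiderDepth_of_adj h with h | h <;> simp [spiderDepth] at h

theorem spider_adj_inl {u : V} {b : SpiderVert V M} (h : (spider V M x).Adj (Sum.inl u) b) :
    u ≠ x ∧ b = legVert M u 1 := by
  obtain ⟨v, p, hv, hp, ⟨h1, rfl⟩ | ⟨h1, rfl⟩⟩ := h
  · obtain ⟨rfl, rfl⟩ := legVert_inj (q := p) (show 0 < M by omega) hp.le
      ((legVert_zero u).trans h1)
    exact ⟨hv, rfl⟩
  · obtain ⟨-, h⟩ := legVert_inj (q := p + 1) (show 0 < M by omega) hp ((legVert_zero u).trans h1)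
    omega

/-- A walk that leaves the leg at `t` is long. -/
theorem spider_walk {l : ℕ} {b : SpiderVert V M} {t : V}
    (h : HasWalk (spider V M x) l b (Sum.inl t)) :
    (∃ p ≤ M, p ≤ l ∧ b = legVert M t p) ∨ 2 * M ≤ l + spiderDepth b := by
  obtain ⟨w, rfl⟩ := h
  generalize ht : (Sum.inl t : SpiderVert V M) = c at w
  induction w with
  | nil => exact Or.inl ⟨0, by omega, le_rfl, ht.symm⟩
  | @cons b b' c h w ih =>
    rw [Walk.length_cons]
    rcases ih ht with ⟨p, hpM, hpl, rfl⟩ | h'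
    · obtain ⟨v, q, -, hq, ⟨rfl, h2⟩ | ⟨rfl, h2⟩⟩ := h
      · have hd := congrArg spiderDepth h2
        rw [spiderDepth_legVert hpM, spiderDepth_legVert hq] at hd
        subst hd
        by_cases hqM : q + 1 < M
        · obtain ⟨rfl, -⟩ := legVert_inj hqM hqM.le h2
          exact Or.inl ⟨q, hq.le, by omega, rfl⟩
        · right
          rw [spiderDepth_legVert hq.le]
          omega
      · have hd := congrArg spiderDepth h2
        rw [spiderDepth_legVert hpM, spiderDepth_legVert hq.le] at hd
        subst hd
        obtain ⟨rfl, -⟩ := legVert_inj hq hq.le h2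
        exact Or.inl ⟨p + 1, hq, by omega, rfl⟩
    · right
      rcases spiderDepth_of_adj h with h | h <;> omega

/-- The depth changes by one along every edge, so the spider is bipartite. -/
theorem spider_oddWalkFree (n : ℕ) : OddWalkFree (spider V M x) n := by
  intro u l hl _ hw
  have := hw.even_iff spiderDepth (by
    intro u v huv
    rcases spiderDepth_of_adj huv with h | h
    · rw [h, Nat.even_add_one]
    · rw [h, Nat.even_add_one]; tauto)
  exact Nat.not_even_iff_odd.2 hl (this.2 Iff.rfl)

theorem hasWalk_leg {v : V} (hv : v ≠ x) {p : ℕ} (hp : p ≤ M) :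
    HasWalk (spider V M x) p (Sum.inl v) (legVert M v p) := by
  induction p with
  | zero => exact HasWalk.zero _ _
  | succ p ih => exact (ih (by omega)).trans (hasWalk_one.2 ⟨v, p, hv, hp, Or.inl ⟨rfl, rfl⟩⟩)

/-- Spider edges join consecutive depths, and legs at different roots meet only at depth `M`, so
edges of `D` and of the spider form no triangle at an outer vertex. The last edge joins depth 0 to
depth `M ≥ 3`, and `x` has no leg, so its ends have no common neighbor. -/
theorem not_triangle_spider (hM : 3 ≤ M) {q : Option (V × Fin M)} {a b : SpiderVert V M}
    (ha : (attach D Function.Embedding.inl (spider V M x) x (Sum.inr none)).Adj (Sum.inr q) a)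
    (hb : (attach D Function.Embedding.inl (spider V M x) x (Sum.inr none)).Adj (Sum.inr q) b) :
    ¬ (attach D Function.Embedding.inl (spider V M x) x (Sum.inr none)).Adj a b := by
  have hcases : ∀ {c d}, (attach D Function.Embedding.inl (spider V M x) x
      (Sum.inr none)).Adj c d → (∃ u v, c = Sum.inl u ∧ d = Sum.inl v) ∨ (spider V M x).Adj c d ∨
      (c = Sum.inl x ∧ d = Sum.inr none) ∨ (c = Sum.inr none ∧ d = Sum.inl x) := by
    rintro c d ((h | h) | h)
    · obtain ⟨u, v, -, h1, h2⟩ := (map_adj _ _ _ _).1 h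
      exact Or.inl ⟨u, v, h1.symm, h2.symm⟩
    · exact Or.inr (Or.inl h)
    · exact Or.inr (Or.inr ((edge_adj ..).1 h).1)
  have hmix : ∀ {b : SpiderVert V M}, (spider V M x).Adj (Sum.inr none) b →
      ¬ (attach D Function.Embedding.inl (spider V M x) x (Sum.inr none)).Adj (Sum.inl x) b := by
    intro b hb hab
    have hd := spiderDepth_of_adj hb
    have hM' : spiderDepth (Sum.inr none : SpiderVert V M) = M := rfl
    rcases hcases hab with ⟨u, v, -, rfl⟩ | h | ⟨-, rfl⟩ | ⟨h, -⟩
    · simp only [spiderDepth] at hd; omega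
    · exact (spider_adj_inl h).1 rfl
    · omega
    · simp at h
  intro hab
  rcases hcases ha with ⟨u, v, h, -⟩ | h1 | ⟨h, -⟩ | ⟨h1, rfl⟩
  · simp at h
  · rcases hcases hb with ⟨u, v, h, -⟩ | h2 | ⟨h, -⟩ | ⟨h2, rfl⟩
    · simp at h
    · have hd1 := spiderDepth_of_adj h1
      have hd2 := spiderDepth_of_adj h2
      have hM' : spiderDepth (Sum.inr none : SpiderVert V M) = M := rfl
      have hx : spiderDepth (Sum.inl x : SpiderVert V M) = 0 := rfl
      rcases hcases hab with ⟨u, v, rfl, rfl⟩ | h3 | ⟨rfl, rfl⟩ | ⟨rfl, rfl⟩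
      · have h1' := (spider_adj_inl h1.symm).2
        have h2' := (spider_adj_inl h2.symm).2
        obtain ⟨rfl, -⟩ := legVert_inj (by omega) (by omega) (h1'.symm.trans h2')
        exact hab.ne rfl
      · have hd3 := spiderDepth_of_adj h3
        omega
      · omega
      · omega
    · simp at h
    · rw [h2] at h1
      exact hmix h1 hab.symm
  · simp at h
  · rcases hcases hb with ⟨u, v, h, -⟩ | h2 | ⟨h, -⟩ | ⟨-, rfl⟩
    · simp at h
    · rw [h1] at h2
      exact hmix h2 hab
    · simp at h
    · exact hab.ne rfl

/-- Vertices outside `V` lie in no triangle, so a clique of size `m ≥ 3` would lie in `D`. -/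
theorem cliqueFree_attach_spider (hm : 3 ≤ m) (hM : 3 ≤ M) (hD : D.CliqueFree m) :
    (attach D Function.Embedding.inl (spider V M x) x (Sum.inr none)).CliqueFree m := by
  classical
  rw [cliqueFree_iff_isEmpty_hom] at hD ⊢
  refine ⟨fun t => ?_⟩
  have hadj : ∀ a b, a ≠ b → (attach D Function.Embedding.inl (spider V M x) x
    (Sum.inr none)).Adj (t a) (t b) := fun a b hab => t.map_adj hab
  have hall : ∀ k, ∃ v, t k = Sum.inl v := by
    intro k
    cases hk : t k with
    | inl v => exact ⟨v, rfl⟩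
    | inr q =>
      exfalso
      obtain ⟨a, ha, b, hb, hab⟩ := Finset.one_lt_card.1
        (show 1 < (Finset.univ.erase k).card by
          rw [Finset.card_erase_of_mem (Finset.mem_univ k), Finset.card_univ, Fintype.card_fin]
          omega)
      have h1 := hadj k a (Finset.ne_of_mem_erase ha).symm
      have h2 := hadj k b (Finset.ne_of_mem_erase hb).symm
      rw [hk] at h1 h2
      exact not_triangle_spider hM h1 h2 (hadj a b hab)
  choose g hg using hall
  refine hD.false ⟨g, fun {a b} hab => ?_⟩
  have := t.map_adj hab
  rw [hg, hg] at this
  rcases this with (h | h) | h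
  · obtain ⟨u, v, huv, h1, h2⟩ := (map_adj _ _ _ _).1 h
    rwa [← Sum.inl_injective h1, ← Sum.inl_injective h2]
  · exact absurd h (spider_not_adj_inl_inl _ _)
  · rw [edge_adj] at h
    rcases h.1 with ⟨-, h⟩ | ⟨h, -⟩ <;> simp at h

/-- If `F` contains an odd cycle of color `i` that is not a triangle, long legs give an edge that
must not have color `i`. -/
theorem exists_isAvoider_of_cycle [Finite V] (hm3 : 3 ≤ m) (hF : IsCycleCliqueFamily m F)
    {i : Fin r} {x y : V} {γ₀ : D.EdgeLabeling (Fin r)} (hm : (D ⊔ edge x y).CliqueFree m)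
    (hγ₀ : IsFree F D γ₀)
    (hbl : ∀ γ, IsFree F D γ → (∀ e : D.edgeSet, x ∉ (e : Sym2 V) → γ e = γ₀ e) → ∃ A ∈ F,
      A.MonoOf i ∧ Nonempty (A.graph →g γ.labelGraph i ⊔ edge x y))
    (hi : ∃ A ∈ F, A.MonoOf i ∧ A.graph ≠ ⊤) :
    ∃ (V' : Type) (_ : Finite V') (G : SimpleGraph V') (ξ : PartialColoring G r) (d : G.Dart),
      IsAvoider F {i} G ξ d := by
  classical
  obtain ⟨A₀, ⟨hA₀, hA₀i, hA₀T⟩, hmax⟩ := Set.exists_max_image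
    {A | A ∈ F ∧ A.MonoOf i ∧ A.graph ≠ ⊤} (fun A => Nat.card A.V)
    (hF.finite.subset fun A hA => hA.1) hi
  replace hmax : ∀ A ∈ F, A.MonoOf i → A.graph ≠ ⊤ → Nat.card A.V ≤ Nat.card A₀.V :=
    fun A h1 h2 h3 => hmax A ⟨h1, h2, h3⟩
  -- An `i`-colored edge at `x`, a leg of length `M` and the last edge form a closed walk of length
  -- `M + 2`, that of a longest cycle. Since 3-cycles are complete, that length is at least 5.
  obtain ⟨M, hM, hML⟩ : ∃ M, 3 ≤ M ∧ Nat.card A₀.V = M + 2 := by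
    refine ⟨Nat.card A₀.V - 2, ?_⟩
    rcases hF.cases hA₀ with ⟨h, -⟩ | ⟨-, hodd, h3, ⟨φ⟩, -⟩
    · exact absurd h hA₀T
    · have h4 : Nat.card A₀.V ≠ 3 := by
        intro h
        rw [h] at φ
        apply hA₀T
        ext a b
        rw [← φ.map_adj_iff, top_adj, ← φ.injective.ne_iff, ← top_adj]
        simp only [cycleGraph_three_eq_top]
      have h5 : Nat.card A₀.V ≠ 4 := by
        intro h
        rw [h] at hodd
        exact absurd hodd (by decide)
      omega
  have hodd₀ : ∀ γ : D.EdgeLabeling (Fin r), IsFree F D γ →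
      OddWalkFree (γ.labelGraph i) (M + 2) := fun γ hγ => hML ▸ hγ.oddWalkFree hF hA₀ hA₀i hA₀T
  refine ⟨SpiderVert V M, inferInstance, _, _, _, isAvoider_attach (ι := Function.Embedding.inl)
    (B := spider V M x) (x := x) (y' := Sum.inr none) hF hγ₀ spider_not_adj_inl_inl
    (fun v h => (spider_adj_inl h).1 rfl) (by simp)
    (cliqueFree_attach_spider hm3 hM (hm.anti le_sup_left)) ?_ ?_ ?_⟩
  · intro γ hγ hγγ
    obtain ⟨A, hA, hAi, hg⟩ := hbl γ hγ hγγ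
    -- The blocked edge cannot be pendant in color `i`, so `x` already has an `i`-colored edge.
    obtain ⟨v, hv⟩ : ∃ v, (γ.labelGraph i).Adj x v := by
      by_contra hcon
      push Not at hcon
      exact not_nonempty_iff.2 (hγ.isEmpty_hom hA hAi) (nonempty_hom_of_pendant hF hA hcon hg)
    refine ⟨A₀, hA₀, hA₀i, ?_⟩
    rcases hF.cases hA₀ with ⟨h, -⟩ | ⟨-, hodd, h3, ⟨φ⟩, -⟩
    · exact absurd h hA₀T
    have h1 : HasWalk ((γ.labelGraph i).map Function.Embedding.inl ⊔ spider V M x ⊔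
        edge (Sum.inl x) (Sum.inr none)) 1 (Sum.inl x) (Sum.inl v) :=
      hasWalk_one.2 (Or.inl (Or.inl ((map_adj _ _ _ _).2 ⟨x, v, hv, rfl, rfl⟩)))
    have h2 : HasWalk ((γ.labelGraph i).map Function.Embedding.inl ⊔ spider V M x ⊔
        edge (Sum.inl x) (Sum.inr none)) M (Sum.inl v) (Sum.inr none) := by
      rw [← legVert_top (by omega) v]
      exact (hasWalk_leg hv.ne' le_rfl).mono (le_sup_right.trans le_sup_left)
    have h3 : HasWalk ((γ.labelGraph i).map Function.Embedding.inl ⊔ spider V M x ⊔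
        edge (Sum.inl x) (Sum.inr none)) 1 (Sum.inr none) (Sum.inl x) :=
      hasWalk_one.2 (Or.inr (by simp [edge_adj]))
    have h4 := (h1.trans h2).trans h3
    rw [show 1 + M + 1 = Nat.card A₀.V by omega] at h4
    obtain ⟨f⟩ := nonempty_hom_cycleGraph (by omega) h4
    exact ⟨f.comp φ.toHom⟩
  · have hfree : OddWalkFree ((γ₀.labelGraph i).map (Function.Embedding.inl :
        V ↪ SpiderVert V M) ⊔ spider V M x) (M + 2) := by
      refine oddWalkFree_sup_of_far (T := Set.range Sum.inl) (fun z u v h1 _ => ?_)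
        ((hodd₀ γ₀ hγ₀).map Sum.inl_injective) (spider_oddWalkFree _) ?_
      · obtain ⟨a, b, -, h, -⟩ := (map_adj _ _ _ _).1 h1
        exact ⟨a, h⟩
      -- Distinct roots are at distance at least `2 * M` in the spider, and `2 * M > M + 2` because
      -- `M ≥ 3`.
      · rintro _ ⟨t, rfl⟩ _ ⟨t', rfl⟩ l hl hw
        rcases spider_walk hw with ⟨p, hp, -, h⟩ | h
        · rw [← legVert_zero (M := M) t] at h
          obtain ⟨rfl, -⟩ := legVert_inj (by omega) hp h
          rfl
        · simp only [spiderDepth] at h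
          omega
    intro A hA hAi
    refine ⟨fun g => ?_⟩
    rcases hF.cases hA with ⟨hT, h3⟩ | ⟨hT, hodd, h3, ⟨φ⟩, -⟩
    -- Cliques of color `i` are excluded as well: they contain a closed walk of length 3.
    · have := A.fin
      have := Fintype.ofFinite A.V
      rw [Nat.card_eq_fintype_card, ← Finset.card_univ] at h3
      obtain ⟨a, b, c, -, -, -, hab, hac, hbc⟩ := Finset.two_lt_card_iff.1
        (show 2 < (Finset.univ : Finset A.V).card by omega)
      have hadj : ∀ {a b}, a ≠ b → A.graph.Adj a b := fun h => by rw [hT]; exact h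
      exact hfree (g a) (1 + 1 + 1) (by decide) (by omega)
        (((hasWalk_one.2 (g.map_adj (hadj hab))).trans (hasWalk_one.2 (g.map_adj (hadj hbc)))).trans
          (hasWalk_one.2 (g.map_adj (hadj hac).symm)))
    · exact ((hfree.mono (hML ▸ hmax A hA hAi hT)).isEmpty_hom hodd h3).false
        (g.comp φ.symm.toHom)
  · intro A hA hAi hT l hw
    have hcard := hmax A hA hAi hT
    -- A lower bound for the distance from `x`: a leg can only be entered after leaving `x`, so the
    -- common end is at distance at least `M + 1`.
    let ψ : SpiderVert V M → ℕ
      | Sum.inl v => if v = x then 0 else 1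
      | Sum.inr (some q) => 1 + q.2
      | Sum.inr none => M + 1
    have hψ : ∀ v p, v ≠ x → p ≤ M → ψ (legVert M v p) = 1 + p := by
      intro v p hv hp
      unfold legVert
      split_ifs with h1 h2
      · simp [ψ, hv, h1]
      · rfl
      · simp only [ψ]; omega
    have h1 := hw.le_add ψ (by
      rintro u v (h | ⟨w, p, hwx, hp, ⟨rfl, rfl⟩ | ⟨rfl, rfl⟩⟩)
      · obtain ⟨a, b, -, rfl, rfl⟩ := (map_adj _ _ _ _).1 h
        simp only [Function.Embedding.inl_apply, ψ]
        split_ifs <;> omega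
      · rw [hψ w p hwx hp.le, hψ w _ hwx hp]; omega
      · rw [hψ w p hwx hp.le, hψ w _ hwx hp]; omega)
    simp only [Function.Embedding.inl_apply, ψ, if_true] at h1
    omega

end Spider

/-! ### Avoiding arbitrary sets of colors -/

/-- For every color there is an edge that must not have this color. -/
theorem exists_isAvoider_singleton (hm : 3 ≤ m) (hF : IsCycleCliqueFamily m F)
    (hmono : ∀ i : Fin r, ∃ A ∈ F, A.MonoOf i ∧ A.graph.CliqueFree m) (i : Fin r) :
    ∃ (V : Type) (_ : Finite V) (G : SimpleGraph V) (ξ : PartialColoring G r) (d : G.Dart),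
      IsAvoider F {i} G ξ d := by
  have : NeZero r := ⟨by rintro rfl; exact i.elim0⟩
  obtain ⟨V, hV, D, x, y, γ₀, hxy, hD, hDm, hγ₀, hbl⟩ := exists_blocked hm hF hmono
  by_cases hi : ∃ A ∈ F, A.MonoOf i ∧ A.graph ≠ ⊤
  · exact exists_isAvoider_of_cycle hm hF hDm hγ₀ (fun γ h1 h2 => hbl γ h1 h2 i) hi
  · push Not at hi
    exact exists_isAvoider_of_clique hF hxy hD hDm hγ₀ (fun γ h1 h2 => hbl γ h1 h2 i) hi

/-- A single edge avoids nothing. -/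
theorem isAvoider_empty (hF : IsCycleCliqueFamily m F) :
    IsAvoider F ∅ (⊤ : SimpleGraph Bool) (fun _ => none) ⟨(false, true), by simp⟩ := by
  refine ⟨rfl, fun e he => absurd rfl he, fun γ _ h => h, fun c _ => ?_⟩
  refine ⟨fun _ => c, ⟨fun _ _ h => absurd h (by simp), ?_⟩, rfl, ?_⟩
  · rintro A hA ⟨f, -⟩
    have hfree : OddWalkFree (⊤ : SimpleGraph Bool) (Nat.card A.V) := by
      intro u l hl _ hw
      have := hw.even_iff (fun b => b.toNat) (by
        intro u v huv
        cases u <;> cases v <;> simp at huv ⊢)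
      exact Nat.not_even_iff_odd.2 hl (this.2 Iff.rfl)
    rcases hF.cases hA with ⟨hT, h3⟩ | ⟨-, hodd, h3, ⟨φ⟩, -⟩
    · have hinj : Function.Injective f := by
        intro a b hab
        by_contra hne
        exact (f.map_adj (show A.graph.Adj a b by rw [hT]; exact hne)).ne hab
      have := Nat.card_le_card_of_injective f hinj
      simp at this
      omega
    · exact (hfree.isEmpty_hom hodd h3).false (f.comp φ.symm.toHom)
  · intro j hj A _ _ _ l hw
    obtain ⟨z, hz⟩ := hw.exists_adj_left (by rintro rfl; simpa using hw.eq_of_zero)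
    obtain ⟨_, h⟩ := (EdgeLabeling.labelGraph_adj _ _).1 hz
    exact absurd h.symm hj

/-- For every set of colors there is an edge that must not have a color in this set. -/
theorem exists_isAvoider (hm : 3 ≤ m) (hF : IsCycleCliqueFamily m F)
    (hmono : ∀ i : Fin r, ∃ A ∈ F, A.MonoOf i ∧ A.graph.CliqueFree m) (S : Set (Fin r)) :
    ∃ (V : Type) (_ : Finite V) (G : SimpleGraph V) (ξ : PartialColoring G r) (d : G.Dart),
      IsAvoider F S G ξ d := by
  induction S, S.toFinite using Set.Finite.induction_on with
  | empty => exact ⟨Bool, inferInstance, _, _, _, isAvoider_empty hF⟩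
  | @insert i S _ _ ih =>
    obtain ⟨V, hV, G, ξ, d, h⟩ := ih
    obtain ⟨W, hW, H, ξ', f, h'⟩ := exists_isAvoider_singleton hm hF hmono i
    exact ⟨GlueVert f d, inferInstance, _, _, _, Set.insert_eq i S ▸ h'.glue hF h⟩

end EdgeCol

theorem mainTheorem6 (r m : ℕ) (hm : 3 ≤ m) (F : Set (EdgeCol.FinColoredGraph r))
    (hF : EdgeCol.IsCycleCliqueFamily m F)
    (hmono : ∀ i : Fin r, ∃ A ∈ F, A.MonoOf i ∧ A.graph.CliqueFree m) :
    (∃ (V : Type) (_ : Finite V) (H : SimpleGraph V) (x : V),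
      (∃ γ, EdgeCol.IsFree F H γ) ∧
      ∀ γ, EdgeCol.IsFree F H γ →
        ∀ i : Fin r, ∃ e : H.edgeSet, x ∈ (e : Sym2 V) ∧ γ e = i) ∧
    (2 ≤ r → ∀ i : Fin r,
      ∃ (V : Type) (_ : Finite V) (D : SimpleGraph V) (ξ : EdgeCol.PartialColoring D r)
        (f : D.edgeSet),
        (∀ γ, EdgeCol.IsFreeExtension F D ξ γ → γ f ≠ i) ∧
        EdgeCol.IsSafe F D ξ f ∧
        EdgeCol.HasFreeEndpoint ξ f) ∧
    (∀ i : Fin r,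
      ∃ (V : Type) (_ : Finite V) (G : SimpleGraph V) (ξ : EdgeCol.PartialColoring G r)
        (e : G.edgeSet),
        EdgeCol.IsDeterminer F i G ξ e ∧
        EdgeCol.IsSafe F G ξ e) := by
  refine ⟨?_, fun hr i => ?_, fun i => ?_⟩
  -- Without colors a single vertex will do; the critical graphs need at least one color.
  · rcases Nat.eq_zero_or_pos r with rfl | hr
    · exact ⟨Unit, inferInstance, ⊥, (), ⟨fun e => absurd e.2 (by simp), EdgeCol.isFree_bot hF _⟩,
        fun _ _ i => i.elim0⟩
    · have : NeZero r := ⟨hr.ne'⟩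
      exact EdgeCol.exists_vertex_all_colors hm hF hmono
  · obtain ⟨V, hV, D, ξ, d, h⟩ := EdgeCol.exists_isAvoider hm hF hmono {i}
    have : Nontrivial (Fin r) := Fin.nontrivial_iff_two_le.2 hr
    -- Safety needs an extension, hence a color that is still allowed.
    obtain ⟨c, hc⟩ := exists_ne i
    exact ⟨V, hV, D, ξ, _, h.notMem, h.isSafe hF hc, h.hasFreeEndpoint⟩
  -- Forbidding every color but `i` forces `i`.
  · obtain ⟨V, hV, D, ξ, d, h⟩ := EdgeCol.exists_isAvoider hm hF hmono {i}ᶜ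
    have hi : i ∉ ({i}ᶜ : Set (Fin r)) := fun hi => hi rfl
    obtain ⟨γ, hγ, -⟩ := h.exists_extension i hi
    exact ⟨V, hV, D, ξ, _, ⟨h.uncolored, h.hasFreeEndpoint, ⟨γ, hγ⟩,
      fun γ hγ => not_not.1 (h.notMem γ hγ)⟩, h.isSafe hF hi⟩
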